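/- Let $n,N\ge 0$, $m\ge 1$ be integers, $A\in\mathbb R^{n\times N}$, $\tau,\lambda,B_{\rm out}>0$, and assume $\tau\|A\|_{2\to2}^2\le 1$, where $\|\cdot\|_{2\to2}$ is the spectral norm. Let $S_t(x)=0$ if $|x|\le t$ and $S_t(x)=x-t\,\mathrm{sign}(x)$ otherwise, applied entrywise to vectors. For $\Phi\in O(N)$, $y\in\mathbb R^n$ and $L\ge 1$ let $$f_1(y)=S_{\tau\lambda}\big(\tau(A\Phi)^\top y\big),\qquad f_l(z)=S_{\tau\lambda}\big[z+\tau(A\Phi)^\top(y-A\Phi z)\big]\quad(l>1),$$ and $f_\Phi^L(y)=f_L\circ\cdots\circ f_1(y)$. Let $\sigma(x)=x$ if $\|x\|_2\le B_{\rm out}$ and $\sigma(x)=B_{\rm out}\,x/\|x\|_2$ otherwise, and put $$\mathcal H_2^L=\{\,y\mapsto\sigma(\Psi f_\Phi^L(y)) : \Psi,\Phi\in O(N)\,\}.$$ Let $\mathcal D$ be a probability distribution on $\mathbb R^N$ with $\|x\|_2\le B_{\rm in}$ almost surely, let $x_1,\dots,x_m$ be drawn i.i.d. from $\mathcal D$,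 put $y_i=Ax_i$, and let $Y\in\mathbb R^{n\times m}$ be the matrix with columns $y_1,\dots,y_m$, with Frobenius norm $\|Y\|_F$. For $h:\mathbb R^n\to\mathbb R^N$ let $\mathcal L(h)=\mathbb E_{x\sim\mathcal D}\|h(Ax)-x\|_2$ and $\hat{\mathcal L}(h)=\frac1m\sum_{i=1}^m\|h(y_i)-x_i\|_2$. Then for every $L\ge1$ and $\delta\in(0,1)$, with probability at least $1-\delta$, all $h\in\mathcal H_2^L$ satisfy $\mathcal L(h)\le\hat{\mathcal L}(h)+\mathcal B_L$, where $$\mathcal B_L = 8B_{\rm out}\sqrt{\tfrac{Nn}{m}}\sqrt{1+\log\Big(2+\tfrac{8L(L+3)\tau\|Y\|_F\|A\|_{2\to2}}{\sqrt m\,B_{\rm out}}\Big)} + 8B_{\rm out}\tfrac{N}{\sqrt m}\sqrt{\log\Big(e\Big(1+\tfrac{8\tau L\|A\|_{2\to2}\|Y\|_F}{\sqrt m\,B_{\rm out}}\Big)\Big)} + 4(B_{\rm in}+B_{\rm out})\sqrt{\tfrac{2\log(4/\delta)}{m}}.$$ Moreover the bound grows only logarithmically in $L$: there is a constant $C$,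 depending on the other parameters but neither on $L$ nor on the sample, such that $\mathcal B_L\le C\sqrt{\log L}$ for all $L\ge2$ and all samples with $\|x_i\|_2\le B_{\rm in}$ for all $i$. -/

import Mathlib

open MeasureTheory

namespace LISTA

noncomputable section

/-- Euclidean space `ℝ^d` with the `ℓ₂`-norm. -/
abbrev Vec (d : ℕ) : Type := EuclideanSpace ℝ (Fin d)

/-- Matrix-vector product `M v` on Euclidean vectors. -/
def mulE {a b : ℕ} (M : Matrix (Fin a) (Fin b) ℝ) (v : Vec b) : Vec a :=
  WithLp.toLp 2 (M.mulVec v.ofLp)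

section Frobenius

open scoped Matrix.Norms.Frobenius

/-- The Frobenius norm `‖M‖_F`. -/
def frobNorm {a b : ℕ} (M : Matrix (Fin a) (Fin b) ℝ) : ℝ := ‖M‖

end Frobenius

section Spectral

open scoped Matrix.Norms.L2Operator

/-- The spectral norm `‖M‖_{2→2}`, the operator norm with respect to the `ℓ₂`-norms. -/
def specNorm {a b : ℕ} (M : Matrix (Fin a) (Fin b) ℝ) : ℝ := ‖M‖

end Spectral

/-- The shrinkage (soft-thresholding) operator `S_t : ℝ → ℝ`. -/
def shrink (t x : ℝ) : ℝ := if |x| ≤ t then 0 else x - t * Real.sign x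

/-- The shrinkage operator applied entry-wise. -/
def shrinkVec {d : ℕ} (t : ℝ) (v : Vec d) : Vec d :=
  WithLp.toLp 2 (fun i => shrink t (v i))

/-- The first layer `f₁(y) = S_{τλ}(τ (AΦ)ᵀ y)`. -/
def firstLayer {n N : ℕ} (A : Matrix (Fin n) (Fin N) ℝ) (τ lam : ℝ)
    (Φ : Matrix (Fin N) (Fin N) ℝ) (y : Vec n) : Vec N :=
  shrinkVec (τ * lam) (τ • mulE (A * Φ).transpose y)

/-- The layer `z ↦ S_{τλ}[z + τ (AΦ)ᵀ (y - (AΦ) z)]`, common to all indices `l > 1`. -/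
def layer {n N : ℕ} (A : Matrix (Fin n) (Fin N) ℝ) (τ lam : ℝ)
    (Φ : Matrix (Fin N) (Fin N) ℝ) (y : Vec n) (z : Vec N) : Vec N :=
  shrinkVec (τ * lam) (z + τ • mulE (A * Φ).transpose (y - mulE (A * Φ) z))

/-- The network `f_Φ^L(y) = f_L ∘ ⋯ ∘ f_1 (y)` with `L ≥ 1` layers and shared dictionary `Φ`. -/
def net {n N : ℕ} (A : Matrix (Fin n) (Fin N) ℝ) (τ lam : ℝ) (L : ℕ)
    (Φ : Matrix (Fin N) (Fin N) ℝ) (y : Vec n) : Vec N :=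
  (layer A τ lam Φ y)^[L - 1] (firstLayer A τ lam Φ y)

/-- The map `σ` onto the `ℓ₂`-ball of radius `B`. -/
def clip {N : ℕ} (B : ℝ) (x : Vec N) : Vec N :=
  if ‖x‖ ≤ B then x else (B / ‖x‖) • x

/-- The hypothesis class `H_2^L = { y ↦ σ(Ψ f_Φ^L(y)) : Ψ, Φ ∈ O(N) }`. -/
def hypClass {n N : ℕ} (A : Matrix (Fin n) (Fin N) ℝ) (τ lam Bout : ℝ) (L : ℕ) :
    Set (Vec n → Vec N) :=
  {h | ∃ Ψ ∈ Matrix.orthogonalGroup (Fin N) ℝ, ∃ Φ ∈ Matrix.orthogonalGroup (Fin N) ℝ,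
    h = fun y => clip Bout (mulE Ψ (net A τ lam L Φ y))}

/-- The reconstruction loss `ℓ(h, x, y) = ‖h(y) - x‖₂`. -/
def loss {n N : ℕ} (h : Vec n → Vec N) (x : Vec N) (y : Vec n) : ℝ := ‖h y - x‖

/-- The true loss `𝓛(h) = 𝔼 ℓ(h, x, y)`, for `x ∼ D` and `y = A x`. -/
def trueLoss {n N : ℕ} (A : Matrix (Fin n) (Fin N) ℝ) (D : Measure (Vec N))
    (h : Vec n → Vec N) : ℝ :=
  ∫ x, loss h x (mulE A x) ∂D

/-- The empirical loss on the sample `(x_i, A x_i)`, `i = 1, …, m`. -/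
def empLoss {n N m : ℕ} (A : Matrix (Fin n) (Fin N) ℝ) (X : Fin m → Vec N)
    (h : Vec n → Vec N) : ℝ :=
  (1 / (m : ℝ)) * ∑ j, loss h (X j) (mulE A (X j))

/-- The matrix `Y = (y_1 | ⋯ | y_m)` whose columns are the measurements `y_i = A x_i`. -/
def measMatrix {n N m : ℕ} (A : Matrix (Fin n) (Fin N) ℝ) (X : Fin m → Vec N) :
    Matrix (Fin n) (Fin m) ℝ :=
  Matrix.of fun k i => mulE A (X i) k

/-- The right-hand side of the generalization bound (without the empirical loss), for `L` layers,
confidence `1 - δ` and the sample `X`. -/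
def genBound {n N m : ℕ} (A : Matrix (Fin n) (Fin N) ℝ) (τ Bin Bout δ : ℝ) (L : ℕ)
    (X : Fin m → Vec N) : ℝ :=
  8 * Bout * √((N : ℝ) * n / m)
      * √(1 + Real.log (2 + 8 * L * (L + 3) * τ * frobNorm (measMatrix A X) * specNorm A
            / (√m * Bout)))
    + 8 * Bout * (N / √m)
      * √(Real.log (Real.exp 1 * (1 + 8 * τ * L * specNorm A * frobNorm (measMatrix A X)
            / (√m * Bout))))
    + 4 * (Bin + Bout) * √(2 * Real.log (4 / δ) / m)

end

end LISTA

namespace LISTA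

noncomputable section

/-! ### Covering numbers of bounded sets in finite-dimensional spaces -/

section Covering

variable {E : Type*} [NormedAddCommGroup E] [NormedSpace ℝ E] [FiniteDimensional ℝ E]

/-! The bound is a Rademacher generalization bound whose complexity term is estimated by chaining
over the parameters `(Ψ, Φ)` instead of over abstract functions.

Probability: for a finite subclass, the supremum `φ` of true minus empirical loss has expectation at
most `2/m` times the expected Rademacher average `R` (symmetrization). The single statistic `φ -
(2/m) R` therefore has nonpositive mean and bounded differences, and one McDiarmid-type estimate
gives an inequality with the Rademacher average of the observed sample. Losses are truncated at `Bin
+ Bout`, which changes them only on a null set but makes them bounded everywhere.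

Geometry: soft thresholding and the projection `σ` are nonexpansive, and `τ‖A‖² ≤ 1` makes `I -
τ(AΦ)ᵀAΦ` nonexpansive. So outputs grow only linearly in `L` and perturbations of `AΦ` only
quadratically, rather than exponentially. The loss vector on the sample is thus Lipschitz in `(Ψ,
AΦ)`. Volumetric nets of `O(N)`, in dimension `N²`, and of `A·O(N)`, in dimension `nN`, cover it;
covering `AΦ` instead of `Φ` produces the factor `√(Nn)`. A dyadic Dudley sum, built from Massart's
lemma, turns the covering numbers into the two square-root-of-log terms. The scalar losses are
chained directly, so no contraction inequality is needed.

Passage to the whole class: the finite estimate does not depend on the number of hypotheses, so it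
survives an increasing union along a dense sequence of `O(N) × O(N)`, and continuity in the
parameters gives all hypotheses. The growth claim holds because the arguments of both logarithms are
at most a constant times `L²` up to a fixed factor. -/

open Metric Module in
-- Volume comparison: the balls of radius `ε/2` around the points are disjoint and lie in the ball
-- of radius `R + ε/2`.
theorem card_le_of_norm_le_of_separated (s : Finset E) {R ε : ℝ} (hR : 0 ≤ R) (hε : 0 < ε)
    (hs : ∀ c ∈ s, ‖c‖ ≤ R) (h : ∀ c ∈ s, ∀ d ∈ s, c ≠ d → ε ≤ ‖c - d‖) :
    (s.card : ℝ) ≤ (1 + 2 * R / ε) ^ finrank ℝ E := by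
  borelize E
  let μ : Measure E := Measure.addHaar
  have hδ : 0 < ε / 2 := by positivity
  have hρ : 0 < R + ε / 2 := by positivity
  have D : Set.Pairwise (s : Set E) (Function.onFun Disjoint fun c => ball (c : E) (ε / 2)) := by
    rintro c hc d hd hcd
    apply ball_disjoint_ball
    rw [dist_eq_norm]
    linarith [h c hc d hd hcd]
  have hsub : (⋃ c ∈ s, ball (c : E) (ε / 2)) ⊆ ball (0 : E) (R + ε / 2) := by
    refine Set.iUnion₂_subset fun x hx => ball_subset_ball' ?_
    rw [dist_zero_right]
    linarith [hs x hx]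
  have I : (s.card : ENNReal) * ENNReal.ofReal ((ε / 2) ^ finrank ℝ E) * μ (ball 0 1) ≤
      ENNReal.ofReal ((R + ε / 2) ^ finrank ℝ E) * μ (ball 0 1) :=
    calc
      _ = μ (⋃ c ∈ s, ball (c : E) (ε / 2)) := by
        rw [measure_biUnion_finset D fun c _ => measurableSet_ball]
        simp only [μ.addHaar_ball_of_pos _ hδ, Finset.sum_const, nsmul_eq_mul, mul_assoc]
      _ ≤ μ (ball (0 : E) (R + ε / 2)) := measure_mono hsub
      _ = _ := by simp only [μ.addHaar_ball_of_pos _ hρ]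
  have J := (ENNReal.mul_le_mul_iff_left (measure_ball_pos _ _ zero_lt_one).ne'
    measure_ball_lt_top.ne).1 I
  have K := ENNReal.toReal_le_of_le_ofReal (pow_nonneg hρ.le _) J
  rw [ENNReal.toReal_mul, ENNReal.toReal_natCast, ENNReal.toReal_ofReal (by positivity)] at K
  have : (1 + 2 * R / ε) = (R + ε / 2) / (ε / 2) := by field_simp; ring
  rw [this, div_pow, le_div_iff₀ (by positivity)]
  exact K

/-- A separated subset of maximal cardinality is a net; the packing bound makes the maximum exist.
The centres lie in `S` so that they can be lifted back to parameters. The weight `c` is a Lipschitz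
constant, possibly zero, which is why the conclusion is not divided by it. -/
theorem exists_finset_net {S : Set E} (hS : S.Nonempty) {R c η : ℝ} (hR : ∀ x ∈ S, ‖x‖ ≤ R)
    (hc : 0 ≤ c) (hη : 0 < η) :
    ∃ T : Finset E, (T : Set E) ⊆ S ∧ T.Nonempty ∧
      (T.card : ℝ) ≤ (1 + 2 * R * c / η) ^ Module.finrank ℝ E ∧
      ∀ s ∈ S, ∃ t ∈ T, c * ‖s - t‖ ≤ η := by
  classical
  obtain ⟨x₀, hx₀⟩ := hS
  have hR0 : 0 ≤ R := (norm_nonneg _).trans (hR _ hx₀)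
  rcases hc.eq_or_lt with rfl | hc
  · exact ⟨{x₀}, by simpa using hx₀, by simp, by simp, fun s _ => ⟨x₀, by simp, by simpa using hη.le⟩⟩
  have hε : 0 < η / c := by positivity
  let K : Set ℕ := {k | ∃ T : Finset E, (T : Set E) ⊆ S ∧
    (∀ a ∈ T, ∀ b ∈ T, a ≠ b → η / c ≤ ‖a - b‖) ∧ T.card = k}
  have hcard : ∀ T : Finset E, (T : Set E) ⊆ S →
      (∀ a ∈ T, ∀ b ∈ T, a ≠ b → η / c ≤ ‖a - b‖) →
      (T.card : ℝ) ≤ (1 + 2 * R * c / η) ^ Module.finrank ℝ E := fun T hT hsep => by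
    have := card_le_of_norm_le_of_separated T hR0 hε (fun a ha => hR a (hT ha)) hsep
    rwa [div_div_eq_mul_div] at this
  have hK : BddAbove K := by
    refine ⟨⌊(1 + 2 * R * c / η) ^ Module.finrank ℝ E⌋₊, ?_⟩
    rintro k ⟨T, hT, hsep, rfl⟩
    exact Nat.le_floor (hcard T hT hsep)
  have hKne : K.Nonempty := ⟨1, {x₀}, by simpa using hx₀, by simp, by simp⟩
  obtain ⟨T, hT, hsep, hmax⟩ := Nat.sSup_mem hKne hK
  have hnet : ∀ s ∈ S, ∃ t ∈ T, c * ‖s - t‖ ≤ η := by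
    intro s hs
    by_contra! hcon
    have hfar : ∀ t ∈ T, η / c ≤ ‖s - t‖ := fun t ht => by
      rw [div_le_iff₀ hc, mul_comm]; exact (hcon t ht).le
    have hsT : s ∉ T := fun hsT => by
      have := hcon s hsT
      simp at this
      linarith
    have hmem : T.card + 1 ∈ K := by
      refine ⟨insert s T, ?_, ?_, Finset.card_insert_of_notMem hsT⟩
      · rw [Finset.coe_insert]; exact Set.insert_subset hs hT
      · intro a ha b hb hab
        rcases Finset.mem_insert.1 ha with h₁ | h₁ <;> rcases Finset.mem_insert.1 hb with h₂ | h₂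
        · exact absurd (h₁.trans h₂.symm) hab
        · rw [h₁]; exact hfar b h₂
        · rw [h₂, norm_sub_rev]; exact hfar a h₁
        · exact hsep a h₁ b h₂ hab
    have := le_csSup hK hmem
    omega
  obtain ⟨t, ht, -⟩ := hnet x₀ hx₀
  exact ⟨T, hT, ⟨t, ht⟩, hcard T hT hsep, hnet⟩

end Covering

/-! ### Rademacher averages of finite families of vectors -/

section Rademacher

/-- The sign encoded by a Boolean. -/
def sgn (b : Bool) : ℝ := if b then 1 else -1

theorem sgn_mul_self (b : Bool) : sgn b * sgn b = 1 := by cases b <;> simp [sgn]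

theorem sgn_sq (b : Bool) : sgn b ^ 2 = 1 := by rw [sq, sgn_mul_self]

theorem abs_sgn (b : Bool) : |sgn b| = 1 := by cases b <;> simp [sgn]

theorem sgn_not (b : Bool) : sgn (!b) = -sgn b := by cases b <;> simp [sgn]

variable {m : ℕ}

/-- The Rademacher average `𝔼_ε sup_i ⟨ε, v i⟩` of a family of vectors. -/
def rad {ι : Type*} (v : ι → Fin m → ℝ) : ℝ :=
  (∑ e : Fin m → Bool, ⨆ i, ∑ j, sgn (e j) * v i j) / 2 ^ m

theorem sum_comp_not (f : (Fin m → Bool) → ℝ) :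
    ∑ e : Fin m → Bool, f (fun j => !(e j)) = ∑ e, f e := by
  refine Fintype.sum_equiv
    (Equiv.piCongrRight fun _ => (Equiv.boolNot : Bool ≃ Bool)) _ _ fun e => rfl

theorem sum_sgn_mul_eq_zero (a : Fin m → ℝ) :
    ∑ e : Fin m → Bool, ∑ j, sgn (e j) * a j = 0 := by
  have h := sum_comp_not (fun e : Fin m → Bool => ∑ j, sgn (e j) * a j)
  simp only [sgn_not, neg_mul, Finset.sum_neg_distrib] at h
  linarith

/-- The sum over sign vectors factors into a product of `2 cosh (a j)`, and `cosh x ≤ exp (x²/2)`.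
-/
theorem sum_exp_sgn_le (a : Fin m → ℝ) :
    ∑ e : Fin m → Bool, Real.exp (∑ j, sgn (e j) * a j)
      ≤ 2 ^ m * Real.exp ((∑ j, a j ^ 2) / 2) := by
  have h1 : ∑ e : Fin m → Bool, Real.exp (∑ j, sgn (e j) * a j)
      = ∏ j, ∑ b : Bool, Real.exp (sgn b * a j) := by
    rw [Finset.prod_univ_sum, Fintype.piFinset_univ]
    exact Finset.sum_congr rfl fun e _ => Real.exp_sum _ _
  have h2 : ∀ j, ∑ b : Bool, Real.exp (sgn b * a j) = 2 * Real.cosh (a j) := fun j => by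
    rw [Real.cosh_eq]; simp [sgn]; ring
  rw [h1, Finset.sum_div, Real.exp_sum]
  calc _ = ∏ j, 2 * Real.cosh (a j) := Finset.prod_congr rfl fun j _ => h2 j
    _ ≤ ∏ j, 2 * Real.exp (a j ^ 2 / 2) := by
        refine Finset.prod_le_prod (fun j _ => ?_) fun j _ => ?_
        · have := Real.cosh_pos (a j); positivity
        · linarith [Real.cosh_le_exp_half_sq (a j)]
    _ = _ := by rw [Finset.prod_mul_distrib]; simp

/-- The optimization over `l` in Chernoff-type arguments: `l = x / b` is optimal, and for `b = 0` a
large `l` is contradictory. -/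
theorem le_sqrt_of_forall_mul_le {x a b : ℝ} (ha : 0 ≤ a) (hb : 0 ≤ b)
    (h : ∀ l : ℝ, 0 < l → l * x ≤ a + l ^ 2 * b / 2) : x ≤ √(2 * a * b) := by
  by_cases hx : x ≤ 0
  · exact hx.trans (Real.sqrt_nonneg _)
  push Not at hx
  apply Real.le_sqrt_of_sq_le
  rcases hb.eq_or_lt with rfl | hb
  · have := h ((a + 1) / x) (by positivity)
    rw [div_mul_cancel₀ _ hx.ne'] at this
    linarith
  · have := h (x / b) (by positivity)
    have e1 : x / b * x = x ^ 2 / b := by ring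
    have e2 : (x / b) ^ 2 * b / 2 = x ^ 2 / b / 2 := by field_simp
    rw [e1, e2] at this
    have h3 : x ^ 2 / b ≤ 2 * a := by linarith
    rwa [div_le_iff₀ hb] at h3

theorem le_iSup_finite {ι : Type*} [Finite ι] (f : ι → ℝ) (i : ι) : f i ≤ ⨆ i, f i :=
  le_ciSup (Set.finite_range f).bddAbove i

/-- Massart's finite class lemma. -/
theorem rad_le_sqrt_log_card {ι : Type*} [Fintype ι] [Nonempty ι] (v : ι → Fin m → ℝ) {r : ℝ} (hr : 0 ≤ r)
    (hv : ∀ i, ∑ j, v i j ^ 2 ≤ r ^ 2) :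
    rad v ≤ r * √(2 * Real.log (Fintype.card ι)) := by
  have hcard : (1 : ℝ) ≤ Fintype.card ι := by exact_mod_cast Fintype.card_pos
  have hkey : rad v ≤ √(2 * Real.log (Fintype.card ι) * r ^ 2) := by
    refine le_sqrt_of_forall_mul_le (Real.log_nonneg hcard) (sq_nonneg r) fun l hl => ?_
    have h2m : (0 : ℝ) < 2 ^ m := by positivity
    -- Jensen for `exp` under the uniform measure on sign vectors; the exponential of the maximum is
    -- then bounded by the sum over the class.
    have hJ : Real.exp (l * rad v)
        ≤ (∑ e : Fin m → Bool, Real.exp (l * ⨆ i, ∑ j, sgn (e j) * v i j)) / 2 ^ m := by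
      have := convexOn_exp.map_sum_le (t := (Finset.univ : Finset (Fin m → Bool)))
        (w := fun _ => ((2 : ℝ) ^ m)⁻¹)
        (p := fun e => l * ⨆ i, ∑ j, sgn (e j) * v i j) (fun _ _ => by positivity)
        (by simp) (fun _ _ => Set.mem_univ _)
      simp only [smul_eq_mul, ← Finset.mul_sum] at this
      rw [rad, div_eq_inv_mul, div_eq_inv_mul]
      refine le_trans (le_of_eq ?_) this
      congr 1
      ring
    have hS : (∑ e : Fin m → Bool, Real.exp (l * ⨆ i, ∑ j, sgn (e j) * v i j))
        ≤ 2 ^ m * (Fintype.card ι * Real.exp (l ^ 2 * r ^ 2 / 2)) := by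
      calc _ ≤ ∑ e : Fin m → Bool, ∑ i, Real.exp (∑ j, sgn (e j) * (l * v i j)) := by
            refine Finset.sum_le_sum fun e _ => ?_
            obtain ⟨i, hi⟩ := exists_eq_ciSup_of_finite (f := fun i => ∑ j, sgn (e j) * v i j)
            rw [← hi, Finset.mul_sum]
            refine le_trans (le_of_eq ?_) (Finset.single_le_sum
              (f := fun i => Real.exp (∑ j, sgn (e j) * (l * v i j)))
              (fun _ _ => (Real.exp_pos _).le) (Finset.mem_univ i))
            congr 1
            exact Finset.sum_congr rfl fun j _ => by ring
        _ = ∑ i, ∑ e : Fin m → Bool, Real.exp (∑ j, sgn (e j) * (l * v i j)) :=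
            Finset.sum_comm
        _ ≤ ∑ i : ι, 2 ^ m * Real.exp (l ^ 2 * r ^ 2 / 2) := by
            refine Finset.sum_le_sum fun i _ => (sum_exp_sgn_le _).trans ?_
            gcongr
            simp only [mul_pow, ← Finset.mul_sum]
            exact mul_le_mul_of_nonneg_left (hv i) (sq_nonneg l)
        _ = _ := by simp; ring
    have hE : Real.exp (l * rad v)
        ≤ Real.exp (Real.log (Fintype.card ι) + l ^ 2 * r ^ 2 / 2) := by
      rw [Real.exp_add, Real.exp_log (by linarith)]
      refine hJ.trans ?_
      rwa [div_le_iff₀ h2m, mul_comm]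
    exact Real.exp_le_exp.1 hE
  rwa [Real.sqrt_mul' _ (sq_nonneg r), Real.sqrt_sq hr, mul_comm] at hkey

/-- One chaining step: replace each vector by its approximant `w (f i)` and pay for the differences.
-/
theorem rad_le_add {ι κ : Type*} [Finite ι] [Nonempty ι] [Finite κ] (v : ι → Fin m → ℝ) (w : κ → Fin m → ℝ) (f : ι → κ) :
    rad v ≤ rad w + rad fun i j => v i j - w (f i) j := by
  rw [rad, rad, rad, ← add_div, ← Finset.sum_add_distrib]
  refine div_le_div_of_nonneg_right (Finset.sum_le_sum fun e _ => ciSup_le fun i => ?_)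
    (by positivity)
  have h1 := le_iSup_finite (fun k => ∑ j, sgn (e j) * w k j) (f i)
  have h2 := le_iSup_finite (fun i => ∑ j, sgn (e j) * (v i j - w (f i) j)) i
  refine le_trans (le_of_eq ?_) (add_le_add h1 h2)
  rw [← Finset.sum_add_distrib]
  exact Finset.sum_congr rfl fun j _ => by ring

theorem rad_le_mul_sqrt {ι : Type*} [Nonempty ι] (v : ι → Fin m → ℝ) {r : ℝ} (hr : 0 ≤ r)
    (hv : ∀ i, ∑ j, v i j ^ 2 ≤ r ^ 2) : rad v ≤ r * √m := by
  rw [rad, div_le_iff₀ (by positivity)]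
  calc _ ≤ ∑ e : Fin m → Bool, r * √m := by
        refine Finset.sum_le_sum fun e _ => ciSup_le fun i => ?_
        refine le_trans (Real.le_sqrt_of_sq_le
          (Finset.sum_mul_sq_le_sq_mul_sq Finset.univ (fun j => sgn (e j)) (v i))) ?_
        simp only [sgn_sq]
        rw [Real.sqrt_le_left (by positivity), mul_pow, Real.sq_sqrt (by positivity)]
        simp only [Finset.sum_const, Finset.card_univ, Fintype.card_fin, nsmul_eq_mul, mul_one]
        rw [mul_comm]
        exact mul_le_mul_of_nonneg_right (hv i) (by positivity)
    _ = _ := by simp; ring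

theorem rad_const (v : Fin m → ℝ) : rad (fun _ : Unit => v) = 0 := by
  simp [rad, sum_sgn_mul_eq_zero]

/-- Dudley's entropy bound, in the form of a sum over dyadic scales. -/
theorem rad_le_dudley_sum {ι : Type*} [Finite ι] [Nonempty ι] {P : Type} (v : P → Fin m → ℝ) (v₀ : Fin m → ℝ) {ρ : ℝ} (hρ : 0 ≤ ρ)
    (h₀ : ∀ p, ∑ j, (v p j - v₀ j) ^ 2 ≤ ρ ^ 2) (N : ℕ → ℝ)
    (hnet : ∀ k, ∃ T : Finset P, T.Nonempty ∧ (T.card : ℝ) ≤ N k ∧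
      ∀ p, ∃ t ∈ T, ∑ j, (v p j - v t j) ^ 2 ≤ (ρ / 2 ^ (k + 1)) ^ 2)
    (p : ι → P) (K : ℕ) :
    rad (fun i => v (p i))
      ≤ ∑ k ∈ Finset.range K, ρ / 2 ^ k * √(2 * Real.log (N k)) + ρ / 2 ^ K * √m := by
  have main : ∀ K : ℕ, ∃ (κ : Type) (_ : Fintype κ) (_ : Nonempty κ) (w : κ → Fin m → ℝ),
      rad w ≤ ∑ k ∈ Finset.range K, ρ / 2 ^ k * √(2 * Real.log (N k)) ∧
      ∀ p, ∃ t, ∑ j, (v p j - w t j) ^ 2 ≤ (ρ / 2 ^ K) ^ 2 := by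
    intro K
    induction K with
    | zero =>
      exact ⟨Unit, inferInstance, inferInstance, fun _ => v₀, by simp [rad_const],
        fun p => ⟨(), by simpa using h₀ p⟩⟩
    | succ K ih =>
      obtain ⟨κ, _, _, w, hw, hcov⟩ := ih
      obtain ⟨T, hTne, hTcard, hT⟩ := hnet K
      choose f hf using hcov
      have : Nonempty T := hTne.to_subtype
      refine ⟨T, inferInstance, inferInstance, fun t => v t, ?_, fun p => ?_⟩
      · rw [Finset.sum_range_succ]
        refine (rad_le_add (fun t : T => v t) w (fun t => f t)).trans (add_le_add hw ?_)
        -- Only the centres `t ∈ T` are linked to the coarser net, so Massart needs `log |T|` and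
        -- not the logarithm of the number of pairs. The coarser net is accurate to `ρ / 2 ^ K`, the
        -- radius of this increment.
        refine (rad_le_sqrt_log_card (ι := T) _ (by positivity) fun t => hf t).trans ?_
        have hc : (0 : ℝ) < T.card := by exact_mod_cast hTne.card_pos
        rw [Fintype.card_coe]
        gcongr
      · obtain ⟨t, ht, h⟩ := hT p
        exact ⟨⟨t, ht⟩, h⟩
  obtain ⟨κ, _, _, w, hw, hcov⟩ := main K
  choose f hf using hcov
  exact (rad_le_add _ w (fun i => f (p i))).trans
    (add_le_add hw (rad_le_mul_sqrt _ (by positivity) fun i => hf (p i)))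

/-- As `log 2 < 0.7`, the `k`-th logarithm is at most `(1 + log (1 + c)) (1 + 0.35 k)²`, and `∑ 2⁻ᵏ
(1 + 0.35 k) = 2.7`. -/
theorem sum_sqrt_log_le {c : ℝ} (hc : 0 ≤ c) (K : ℕ) :
    ∑ k ∈ Finset.range K, 1 / 2 ^ k * √(Real.log (1 + c * 2 ^ k))
      ≤ 2.7 * √(1 + Real.log (1 + c)) := by
  set X := 1 + Real.log (1 + c) with hX
  have hlog : 0 ≤ Real.log (1 + c) := Real.log_nonneg (by linarith)
  have hterm : ∀ k : ℕ, √(Real.log (1 + c * 2 ^ k)) ≤ √X * (1 + 0.35 * k) := by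
    intro k
    rw [Real.sqrt_le_left (by positivity), mul_pow, Real.sq_sqrt (by positivity)]
    have h1 : Real.log (1 + c * 2 ^ k) ≤ Real.log ((1 + c) * 2 ^ k) := by
      apply Real.log_le_log (by positivity)
      have : (1 : ℝ) ≤ 2 ^ k := one_le_pow₀ (by norm_num)
      nlinarith
    rw [Real.log_mul (by positivity) (by positivity), Real.log_pow] at h1
    have h2 := Real.log_two_lt_d9
    have hk : (0 : ℝ) ≤ k := by positivity
    nlinarith [mul_nonneg hk hlog, mul_nonneg (sq_nonneg (k : ℝ)) hlog, sq_nonneg (k : ℝ)]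
  have hsum : ∀ K : ℕ, ∑ k ∈ Finset.range K, 1 / (2 : ℝ) ^ k * (1 + 0.35 * k)
      = 2.7 - (2.7 + 0.7 * K) / 2 ^ K := by
    intro K
    induction K with
    | zero => simp
    | succ K ih => rw [Finset.sum_range_succ, ih, pow_succ]; push_cast; field_simp; ring
  calc _ ≤ ∑ k ∈ Finset.range K, √X * (1 / (2 : ℝ) ^ k * (1 + 0.35 * k)) := by
        refine Finset.sum_le_sum fun k _ => ?_
        calc _ ≤ 1 / 2 ^ k * (√X * (1 + 0.35 * k)) := by gcongr; exact hterm k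
          _ = _ := by ring
    _ = √X * (2.7 - (2.7 + 0.7 * K) / 2 ^ K) := by rw [← Finset.mul_sum, hsum]
    _ ≤ √X * 2.7 := by
        gcongr
        have : (0 : ℝ) ≤ (2.7 + 0.7 * K) / 2 ^ K := by positivity
        linarith
    _ = _ := mul_comm _ _

end Rademacher

/-! ### The bounded differences inequality -/

section BoundedDifferences

variable {α : Type*} [MeasurableSpace α]

theorem integrable_of_abs_le {μ : Measure α} [IsFiniteMeasure μ] {f : α → ℝ} (hf : Measurable f)
    {B : ℝ} (hB : ∀ x, |f x| ≤ B) : Integrable f μ :=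
  Integrable.of_bound hf.aestronglyMeasurable B (Filter.Eventually.of_forall hB)

/-- Hoeffding's lemma on the interval of length `2d` around one value of `f`; the sharper interval
of length `d` is not needed for the final constants. -/
theorem integral_exp_sub_integral_le (μ : Measure α) [IsProbabilityMeasure μ] {f : α → ℝ}
    (hf : Measurable f) {d : ℝ} (hd : ∀ x y, |f x - f y| ≤ d) (s : ℝ) :
    ∫ x, Real.exp (s * (f x - ∫ y, f y ∂μ)) ∂μ ≤ Real.exp (s ^ 2 * d ^ 2 / 2) := by
  have : Nonempty α := nonempty_of_isProbabilityMeasure μ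
  obtain ⟨x₀⟩ := this
  have hd0 : 0 ≤ d := (abs_nonneg _).trans (hd x₀ x₀)
  have hb : ∀ x, f x ∈ Set.Icc (f x₀ - d) (f x₀ + d) := fun x => by
    have := abs_le.1 (hd x x₀)
    constructor <;> linarith
  have h := (ProbabilityTheory.hasSubgaussianMGF_of_mem_Icc hf.aemeasurable
    (Filter.Eventually.of_forall hb) (μ := μ)).mgf_le s
  rw [ProbabilityTheory.mgf] at h
  refine h.trans (le_of_eq ?_)
  congr 1
  have e : ‖f x₀ + d - (f x₀ - d)‖ = 2 * d := by
    rw [Real.norm_eq_abs, abs_of_nonneg] <;> linarith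
  push_cast
  rw [e]
  ring

/-- Induction on the number of coordinates. Averaging out the first one gives a function `G` of the
others with the same bounded differences; Hoeffding's lemma controls `F - G` with the others fixed,
and the induction hypothesis controls `G`. -/
theorem integral_exp_le_of_bounded_differences (μ : Measure α) [IsProbabilityMeasure μ] {d : ℝ} :
    ∀ (m : ℕ) (F : (Fin m → α) → ℝ), Measurable F →
      (∀ X i x, |F (Function.update X i x) - F X| ≤ d) → (∃ B, ∀ X, |F X| ≤ B) →
      ∀ s : ℝ, ∫ X, Real.exp (s * (F X - ∫ Z, F Z ∂Measure.pi fun _ => μ)) ∂(Measure.pi fun _ => μ)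
        ≤ Real.exp (m * (s ^ 2 * d ^ 2 / 2)) := by
  intro m
  induction m with
  | zero =>
    intro F hF _ _ s
    have hc : ∀ X, F X = F Fin.elim0 := fun X => congrArg F (Subsingleton.elim _ _)
    simp [hc]
  | succ m ih =>
    intro F hF hd ⟨B, hB⟩ s
    set π : Measure (Fin m → α) := Measure.pi fun _ => μ
    set e := MeasurableEquiv.piFinSuccAbove (fun _ : Fin (m + 1) => α) 0
    have hmp : MeasurePreserving e (Measure.pi fun _ => μ) (μ.prod π) :=
      measurePreserving_piFinSuccAbove (fun _ : Fin (m + 1) => μ) 0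
    have hes : ∀ p : α × (Fin m → α), e.symm p = Fin.cons p.1 p.2 := fun p => by
      simp [e, MeasurableEquiv.piFinSuccAbove, Fin.insertNthEquiv]
    have hint : ∀ G : (Fin (m + 1) → α) → ℝ,
        ∫ X, G X ∂(Measure.pi fun _ => μ) = ∫ p, G (e.symm p) ∂(μ.prod π) := fun G =>
      (hmp.symm.integral_comp' G).symm
    set H : α × (Fin m → α) → ℝ := fun p => F (e.symm p) with hH
    have hHm : Measurable H := hF.comp e.symm.measurable
    have hHB : ∀ p, |H p| ≤ B := fun p => hB _
    have hHd : ∀ X x y, |H (x, X) - H (y, X)| ≤ d := fun X x y => by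
      have := hd (Fin.cons y X) 0 x
      rw [Fin.update_cons_zero] at this
      simpa only [hH, hes] using this
    set G : (Fin m → α) → ℝ := fun X => ∫ x, H (x, X) ∂μ with hG
    have hGm : Measurable G := by
      have := hHm.stronglyMeasurable.integral_prod_left' (μ := μ)
      exact this.measurable
    have hHi : ∀ X, Integrable (fun x => H (x, X)) μ := fun X =>
      integrable_of_abs_le (hHm.comp measurable_prodMk_right) fun x => hHB _
    have hGB : ∀ X, |G X| ≤ B := fun X => by
      have := norm_integral_le_of_norm_le_const (μ := μ) (f := fun x => H (x, X)) (C := B)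
        (Filter.Eventually.of_forall fun x => hHB _)
      simpa using this
    have hGd : ∀ X i x, |G (Function.update X i x) - G X| ≤ d := fun X i x => by
      rw [hG]
      simp only
      rw [← integral_sub (hHi _) (hHi _)]
      have := norm_integral_le_of_norm_le_const (μ := μ)
        (f := fun y => H (y, Function.update X i x) - H (y, X)) (C := d)
        (Filter.Eventually.of_forall fun y => by
          simp only [hH, hes, Real.norm_eq_abs]
          have := hd (Fin.cons y X) i.succ x
          rwa [← Fin.cons_update] at this)
      simpa using this
    have hEF : ∫ X, F X ∂(Measure.pi fun _ => μ) = ∫ X, G X ∂π := by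
      rw [hint]
      exact integral_prod_symm _ (integrable_of_abs_le hHm hHB)
    rw [hint, hEF]
    set c := ∫ X, G X ∂π with hc
    have hexpB : ∀ p, |Real.exp (s * (H p - c))| ≤ Real.exp (|s| * (B + |c|)) := fun p => by
      rw [abs_of_pos (Real.exp_pos _), Real.exp_le_exp]
      refine (le_abs_self _).trans ?_
      rw [abs_mul]
      gcongr
      exact (abs_sub _ _).trans (by gcongr; exact hHB p)
    have hexpG : ∀ X, |Real.exp (s * (G X - c))| ≤ Real.exp (|s| * (B + |c|)) := fun p => by
      rw [abs_of_pos (Real.exp_pos _), Real.exp_le_exp]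
      refine (le_abs_self _).trans ?_
      rw [abs_mul]
      gcongr
      exact (abs_sub _ _).trans (by gcongr; exact hGB p)
    have hexpm : Measurable fun p => Real.exp (s * (H p - c)) := by fun_prop
    have hexpGm : Measurable fun X => Real.exp (s * (G X - c)) := by fun_prop
    rw [integral_prod_symm _ (integrable_of_abs_le hexpm hexpB)]
    calc ∫ X, ∫ x, Real.exp (s * (H (x, X) - c)) ∂μ ∂π
        ≤ ∫ X, Real.exp (s ^ 2 * d ^ 2 / 2) * Real.exp (s * (G X - c)) ∂π := by
          refine integral_mono_of_nonneg
            (Filter.Eventually.of_forall fun X => integral_nonneg fun x => (Real.exp_pos _).le)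
            ((integrable_of_abs_le hexpGm hexpG).const_mul _)
            (Filter.Eventually.of_forall fun X => ?_)
          have h1 : ∀ x, Real.exp (s * (H (x, X) - c))
              = Real.exp (s * (H (x, X) - G X)) * Real.exp (s * (G X - c)) := fun x => by
            rw [← Real.exp_add]; congr 1; ring
          simp only [h1]
          rw [integral_mul_const]
          refine mul_le_mul_of_nonneg_right ?_ (Real.exp_pos _).le
          exact integral_exp_sub_integral_le μ (hHm.comp measurable_prodMk_right) (hHd X) s
      _ ≤ Real.exp (s ^ 2 * d ^ 2 / 2) * Real.exp (m * (s ^ 2 * d ^ 2 / 2)) := by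
          rw [integral_const_mul]
          exact mul_le_mul_of_nonneg_left (ih G hGm hGd ⟨B, hGB⟩ s) (Real.exp_pos _).le
      _ = _ := by rw [← Real.exp_add]; congr 1; push_cast; ring

theorem measureReal_bounded_differences_le (μ : Measure α) [IsProbabilityMeasure μ] {d : ℝ}
    (hd0 : 0 < d) {m : ℕ} (hm : 1 ≤ m) {F : (Fin m → α) → ℝ} (hF : Measurable F)
    (hd : ∀ X i x, |F (Function.update X i x) - F X| ≤ d) (hB : ∃ B, ∀ X, |F X| ≤ B)
    {δ : ℝ} (hδ : δ ∈ Set.Ioo (0 : ℝ) 1) :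
    (Measure.pi fun _ : Fin m => μ).real
      {X | ∫ Z, F Z ∂(Measure.pi fun _ => μ) + d * √(2 * m * Real.log (1 / δ)) ≤ F X} ≤ δ := by
  set π : Measure (Fin m → α) := Measure.pi fun _ => μ
  set c := ∫ Z, F Z ∂π
  set w := √(2 * m * Real.log (1 / δ)) with hw
  obtain ⟨B, hB⟩ := hB
  have hm0 : (0 : ℝ) < m := by exact_mod_cast hm
  have hlog : 0 < Real.log (1 / δ) := Real.log_pos (by rw [lt_div_iff₀ hδ.1]; linarith [hδ.2])
  have hw2 : w ^ 2 = 2 * m * Real.log (1 / δ) := Real.sq_sqrt (by positivity)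
  have hw0 : 0 < w := Real.sqrt_pos.2 (by positivity)
  -- The minimizer of the Chernoff exponent `m s² d² / 2 - s d w`, whose minimum is `-w² / (2m) =
  -- log δ`.
  set s := w / (m * d) with hs
  have hs0 : 0 < s := by positivity
  have hexpB : ∀ X, |Real.exp (s * (F X - c))| ≤ Real.exp (s * (B + |c|)) := fun X => by
    rw [abs_of_pos (Real.exp_pos _), Real.exp_le_exp]
    gcongr
    have h1 := le_abs_self (F X)
    have h2 := neg_abs_le c
    linarith [hB X]
  have hmk := mul_meas_ge_le_integral_of_nonneg (μ := π)
    (Filter.Eventually.of_forall fun X => (Real.exp_pos (s * (F X - c))).le)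
    (integrable_of_abs_le (by fun_prop) hexpB) (Real.exp (s * (d * w)))
  have hmg := hmk.trans (integral_exp_le_of_bounded_differences μ m F hF hd ⟨B, hB⟩ s)
  have hset : {X | Real.exp (s * (d * w)) ≤ Real.exp (s * (F X - c))}
      = {X | c + d * w ≤ F X} := by
    ext X
    simp only [Set.mem_ofPred_eq, Real.exp_le_exp, mul_le_mul_iff_right₀ hs0]
    constructor <;> intro h <;> linarith
  rw [hset, mul_comm, ← le_div_iff₀ (Real.exp_pos _), ← Real.exp_sub] at hmg
  refine hmg.trans (le_of_eq ?_)
  have : m * (s ^ 2 * d ^ 2 / 2) - s * (d * w) = Real.log δ := by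
    have h1 : m * (s ^ 2 * d ^ 2 / 2) - s * (d * w) = - (w ^ 2 / (2 * m)) := by
      rw [hs]; field_simp; ring
    rw [h1, hw2, one_div, Real.log_inv]; field_simp
  rw [this, Real.exp_log hδ.1]

end BoundedDifferences

/-! ### Symmetrization -/

section Symmetrization

variable {α : Type*} [MeasurableSpace α] {m : ℕ} {ι : Type*} [Finite ι] [Nonempty ι]

theorem abs_iSup_sub_iSup_le {f g : ι → ℝ} {B : ℝ} (h : ∀ i, |f i - g i| ≤ B) :
    |(⨆ i, f i) - ⨆ i, g i| ≤ B := by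
  have h1 : ⨆ i, f i ≤ (⨆ i, g i) + B := ciSup_le fun i => by
    linarith [le_iSup_finite g i, (abs_le.1 (h i)).2]
  have h2 : ⨆ i, g i ≤ (⨆ i, f i) + B := ciSup_le fun i => by
    linarith [le_iSup_finite f i, (abs_le.1 (h i)).1]
  rw [abs_le]; constructor <;> linarith

theorem abs_iSup_le {f : ι → ℝ} {B : ℝ} (h : ∀ i, |f i| ≤ B) : |⨆ i, f i| ≤ B := by
  have := abs_iSup_sub_iSup_le (f := f) (g := fun _ => 0) (B := B) (by simpa using h)
  simpa using this

theorem abs_rad_sub_rad_le {v w : ι → Fin m → ℝ} {B : ℝ}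
    (h : ∀ (e : Fin m → Bool) (i), |∑ j, sgn (e j) * v i j - ∑ j, sgn (e j) * w i j| ≤ B) :
    |rad v - rad w| ≤ B := by
  rw [rad, rad, ← sub_div, ← Finset.sum_sub_distrib, abs_div, abs_of_pos (a := (2 : ℝ) ^ m)
    (by positivity), div_le_iff₀ (by positivity)]
  calc _ ≤ ∑ e : Fin m → Bool, B := (Finset.abs_sum_le_sum_abs _ _).trans
        (Finset.sum_le_sum fun e _ => abs_iSup_sub_iSup_le (h e))
    _ = _ := by simp; ring

theorem abs_sum_mul_le {s a : Fin m → ℝ} {c : ℝ} (hs : ∀ j, |s j| = 1) (ha : ∀ j, |a j| ≤ c) :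
    |∑ j, s j * a j| ≤ m * c := by
  calc _ ≤ ∑ j : Fin m, c := (Finset.abs_sum_le_sum_abs _ _).trans
        (Finset.sum_le_sum fun j _ => by rw [abs_mul, hs, one_mul]; exact ha j)
    _ = _ := by simp

theorem abs_rad_le {v : ι → Fin m → ℝ} {c : ℝ} (h : ∀ i j, |v i j| ≤ c) : |rad v| ≤ m * c := by
  have h0 : rad (fun (_ : ι) (_ : Fin m) => (0 : ℝ)) = 0 := by simp [rad]
  have := abs_rad_sub_rad_le (v := v) (w := fun _ _ => 0) (B := m * c) fun e i => by
    simpa using abs_sum_mul_le (fun j => abs_sgn (e j)) (h i)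
  simpa [h0] using this

theorem abs_sum_update_sub_le {α : Type*} (s : Fin m → ℝ) (hs : ∀ j, |s j| = 1) {g : α → ℝ} {c : ℝ}
    (hg : ∀ x, g x ∈ Set.Icc 0 c) (X : Fin m → α) (k : Fin m) (x : α) :
    |∑ j, s j * g (Function.update X k x j) - ∑ j, s j * g (X j)| ≤ c := by
  rw [← Finset.sum_sub_distrib, Finset.sum_eq_single k]
  · rw [← mul_sub, abs_mul, hs, one_mul, Function.update_self, abs_le]
    constructor <;> linarith [(hg x).1, (hg x).2, (hg (X k)).1, (hg (X k)).2]
  · intro j _ hj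
    rw [Function.update_of_ne hj, sub_self]
  · simp

theorem rad_neg {ι : Type*} (v : ι → Fin m → ℝ) : rad (fun i j => -v i j) = rad v := by
  rw [rad, rad, ← sum_comp_not (fun e => ⨆ i, ∑ j, sgn (e j) * v i j)]
  simp only [sgn_not, neg_mul, mul_neg]

theorem rad_sub_le (v w : ι → Fin m → ℝ) : rad (fun i j => v i j - w i j) ≤ rad v + rad w := by
  have := rad_le_add (fun i j => v i j - w i j) v id
  simp only [id, sub_sub_cancel_left] at this
  rwa [rad_neg] at this

theorem measurable_rad {ι : Type*} [Finite ι] {v : ι → α → Fin m → ℝ} (hv : ∀ i j, Measurable fun x => v i x j) :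
    Measurable fun x => rad fun i => v i x := by
  unfold rad
  refine Measurable.div_const (Finset.measurable_sum _ fun e _ => Measurable.iSup fun i => ?_) _
  exact Finset.measurable_sum _ fun j _ => (hv i j).const_mul _

variable (μ : Measure α) [IsProbabilityMeasure μ]

/-- Exchanging the two members of the pairs with negative sign preserves the product measure. -/
theorem integral_iSup_sum_swap_eq {ι : Type*} [Finite ι] {g : ι → α → ℝ} (hg : ∀ i, Measurable (g i))
    (e : Fin m → Bool) :
    ∫ Z : Fin m → α × α, ⨆ i, ∑ j, sgn (e j) * (g i (Z j).1 - g i (Z j).2)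
        ∂(Measure.pi fun _ => μ.prod μ)
      = ∫ Z : Fin m → α × α, ⨆ i, ∑ j, (g i (Z j).1 - g i (Z j).2)
        ∂(Measure.pi fun _ => μ.prod μ) := by
  have hmp : MeasurePreserving
      (fun (Z : Fin m → α × α) j => (if e j then id else Prod.swap : α × α → α × α) (Z j))
      (Measure.pi fun _ => μ.prod μ) (Measure.pi fun _ => μ.prod μ) := by
    refine measurePreserving_pi (fun _ => μ.prod μ) (fun _ => μ.prod μ)
      (f := fun j => if e j then id else Prod.swap) fun j => ?_
    cases e j
    · simpa using Measure.measurePreserving_swap (μ := μ) (ν := μ)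
    · simpa using MeasurePreserving.id _
  have hmeas : Measurable fun Z : Fin m → α × α => ⨆ i, ∑ j, (g i (Z j).1 - g i (Z j).2) :=
    Measurable.iSup fun i => by have := hg i; fun_prop
  have hmap := integral_map (μ := Measure.pi fun _ => μ.prod μ) hmp.measurable.aemeasurable
    hmeas.aestronglyMeasurable
  rw [hmp.map_eq] at hmap
  rw [hmap]
  refine integral_congr_ae (Filter.Eventually.of_forall fun Z => ?_)
  refine iSup_congr fun i => Finset.sum_congr rfl fun j _ => ?_
  by_cases h : e j <;> simp [sgn, h]

/-- Symmetrization: write the true mean as an average over a ghost sample, pull the supremum inside,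
average over random swaps of the two samples, and split the Rademacher average of the differences.
-/
theorem integral_iSup_le_integral_rad (hm : 1 ≤ m) {g : ι → α → ℝ} (hg : ∀ i, Measurable (g i))
    {c : ℝ} (hc : ∀ i x, g i x ∈ Set.Icc 0 c) :
    ∫ X : Fin m → α, ⨆ i, (∫ x, g i x ∂μ - 1 / (m : ℝ) * ∑ j, g i (X j)) ∂(Measure.pi fun _ => μ)
      ≤ 2 / m * ∫ X : Fin m → α, rad (fun i j => g i (X j)) ∂(Measure.pi fun _ => μ) := by
  have hm0 : (0 : ℝ) < m := by exact_mod_cast hm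
  set π : Measure (Fin m → α) := Measure.pi fun _ => μ
  set Q : Measure (Fin m → α × α) := Measure.pi fun _ => μ.prod μ
  have habs : ∀ i x, |g i x| ≤ c := fun i x => by
    rw [abs_of_nonneg (hc i x).1]; exact (hc i x).2
  have habs2 : ∀ i x y, |g i x - g i y| ≤ c := fun i x y => by
    rw [abs_le]
    constructor <;> linarith [(hc i x).1, (hc i x).2, (hc i y).1, (hc i y).2]
  have hone : ∀ a : Fin m → ℝ, (∀ j, |a j| ≤ c) → |∑ j, a j| ≤ m * c := fun a ha => by
    simpa using abs_sum_mul_le (s := fun _ => 1) (by simp) ha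
  have hgi : ∀ i, Integrable (g i) μ := fun i => integrable_of_abs_le (hg i) (habs i)
  have hmean : ∀ i, ∫ X : Fin m → α, ∑ j, g i (X j) ∂π = m * ∫ x, g i x ∂μ := fun i => by
    rw [integral_finsetSum _ fun j _ => integrable_of_abs_le (f := fun X : Fin m → α => g i (X j))
      ((hg i).comp (measurable_pi_apply j)) fun X => habs i _]
    have : ∀ j, ∫ X : Fin m → α, g i (X j) ∂π = ∫ x, g i x ∂μ := fun j => by
      have hmp := measurePreserving_eval (fun _ : Fin m => μ) j
      rw [← hmp.map_eq, integral_map hmp.measurable.aemeasurable (hg i).aestronglyMeasurable]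
    simp [this]
  set S : (Fin m → α) × (Fin m → α) → ℝ := fun p => ⨆ i, ∑ j, (g i (p.1 j) - g i (p.2 j)) with hS
  have hSm : Measurable S := Measurable.iSup fun i => by have := hg i; fun_prop
  have hSB : ∀ p, |S p| ≤ m * c := fun p => abs_iSup_le fun i => hone _ fun j => habs2 i _ _
  have hradm : Measurable fun X : Fin m → α => rad fun i j => g i (X j) :=
    measurable_rad (v := fun i (X : Fin m → α) j => g i (X j)) fun i j => by
      have := hg i; fun_prop
  have hradi : Integrable (fun X : Fin m → α => rad fun i j => g i (X j)) π :=
    integrable_of_abs_le hradm fun X => abs_rad_le fun i j => habs i _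
  have step1 : ∫ X : Fin m → α, ⨆ i, (∫ x, g i x ∂μ - 1 / (m : ℝ) * ∑ j, g i (X j)) ∂π
      ≤ 1 / m * ∫ p, S p ∂(π.prod π) := by
    rw [integral_prod_symm _ (integrable_of_abs_le hSm hSB), ← integral_const_mul]
    refine integral_mono (integrable_of_abs_le (B := c) (Measurable.iSup fun i => ?_) fun X => ?_)
      (Integrable.const_mul (integrable_of_abs_le (B := m * c) ?_ ?_) _) fun X => ciSup_le fun i => ?_
    · have := hg i; fun_prop
    · refine abs_iSup_le fun i => ?_
      have h1 : 0 ≤ ∫ x, g i x ∂μ := integral_nonneg fun x => (hc i x).1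
      have h2 : ∫ x, g i x ∂μ ≤ c := by
        have := integral_mono (hgi i) (integrable_const c) fun x => (hc i x).2
        simpa using this
      have h3 : 0 ≤ ∑ j, g i (X j) := Finset.sum_nonneg fun j _ => (hc i _).1
      have h4 : ∑ j, g i (X j) ≤ m * c := (le_abs_self _).trans (hone _ fun j => habs i _)
      have h5 : 1 / (m : ℝ) * ∑ j, g i (X j) ≤ c := by
        rw [one_div, inv_mul_le_iff₀ hm0]; exact h4
      have h6 : 0 ≤ 1 / (m : ℝ) * ∑ j, g i (X j) := by positivity
      rw [abs_le]; constructor <;> linarith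
    · exact (hSm.stronglyMeasurable.integral_prod_left' (μ := π)).measurable
    · intro X
      have := norm_integral_le_of_norm_le_const (μ := π) (f := fun Y => S (Y, X)) (C := m * c)
        (Filter.Eventually.of_forall fun Y => hSB _)
      simpa using this
    · have h1 : ∫ Y : Fin m → α, ∑ j, (g i (Y j) - g i (X j)) ∂π ≤ ∫ Y, S (Y, X) ∂π :=
        integral_mono
          (integrable_of_abs_le (by have := hg i; fun_prop) fun Y => hone _ fun j => habs2 i _ _)
          (integrable_of_abs_le (hSm.comp measurable_prodMk_right) fun Y => hSB _)
          fun Y => le_iSup_finite (fun i => ∑ j, (g i (Y j) - g i (X j))) i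
      simp only [Finset.sum_sub_distrib] at h1
      rw [integral_sub (integrable_of_abs_le (by have := hg i; fun_prop)
        fun Y => hone _ fun j => habs i _) (integrable_const _), hmean] at h1
      simp only [integral_const, probReal_univ, one_smul] at h1
      have h2 := mul_le_mul_of_nonneg_left h1 (a := 1 / (m : ℝ)) (by positivity)
      refine le_trans (le_of_eq ?_) h2
      field_simp
  have step2 : ∫ p, S p ∂(π.prod π)
      = ∫ Z : Fin m → α × α, ⨆ i, ∑ j, (g i (Z j).1 - g i (Z j).2) ∂Q := by
    have hmp := measurePreserving_arrowProdEquivProdArrow α α (Fin m) (fun _ => μ) (fun _ => μ)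
    exact (hmp.integral_comp' S).symm
  have step3 : ∫ Z : Fin m → α × α, ⨆ i, ∑ j, (g i (Z j).1 - g i (Z j).2) ∂Q
      = ∫ Z : Fin m → α × α, rad (fun i j => g i (Z j).1 - g i (Z j).2) ∂Q := by
    unfold rad
    rw [integral_div, integral_finsetSum]
    · simp only [Q, integral_iSup_sum_swap_eq μ hg]
      simp
    · intro e _
      exact integrable_of_abs_le (B := m * c) (Measurable.iSup fun i => by have := hg i; fun_prop)
        fun Z => abs_iSup_le fun i => abs_sum_mul_le (fun j => abs_sgn _) fun j => habs2 i _ _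
  have hfst : MeasurePreserving (fun (Z : Fin m → α × α) j => (Z j).1) Q π :=
    measurePreserving_pi (fun _ => μ.prod μ) (fun _ => μ) (f := fun _ => Prod.fst)
      fun _ => measurePreserving_fst
  have hsnd : MeasurePreserving (fun (Z : Fin m → α × α) j => (Z j).2) Q π :=
    measurePreserving_pi (fun _ => μ.prod μ) (fun _ => μ) (f := fun _ => Prod.snd)
      fun _ => measurePreserving_snd
  have step4 : ∫ Z : Fin m → α × α, rad (fun i j => g i (Z j).1 - g i (Z j).2) ∂Q
      ≤ 2 * ∫ X : Fin m → α, rad (fun i j => g i (X j)) ∂π := by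
    have e1 : ∫ X : Fin m → α, rad (fun i j => g i (X j)) ∂π
        = ∫ Z : Fin m → α × α, rad (fun i j => g i (Z j).1) ∂Q := by
      rw [← hfst.map_eq, integral_map hfst.measurable.aemeasurable hradm.aestronglyMeasurable]
    have e2 : ∫ X : Fin m → α, rad (fun i j => g i (X j)) ∂π
        = ∫ Z : Fin m → α × α, rad (fun i j => g i (Z j).2) ∂Q := by
      rw [← hsnd.map_eq, integral_map hsnd.measurable.aemeasurable hradm.aestronglyMeasurable]
    have i1 : Integrable (fun Z : Fin m → α × α => rad fun i j => g i (Z j).1) Q :=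
      hfst.integrable_comp_of_integrable hradi
    have i2 : Integrable (fun Z : Fin m → α × α => rad fun i j => g i (Z j).2) Q :=
      hsnd.integrable_comp_of_integrable hradi
    rw [two_mul]
    nth_rewrite 1 [e1]
    rw [e2, ← integral_add i1 i2]
    refine integral_mono (integrable_of_abs_le (B := m * c) ?_ fun Z => ?_) (i1.add i2)
      fun Z => rad_sub_le (fun i j => g i (Z j).1) (fun i j => g i (Z j).2)
    · exact measurable_rad (v := fun i (Z : Fin m → α × α) j => g i (Z j).1 - g i (Z j).2)
        fun i j => by have := hg i; fun_prop
    · exact abs_rad_le fun i j => habs2 i _ _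
  calc _ ≤ 1 / m * ∫ p, S p ∂(π.prod π) := step1
    _ ≤ 1 / m * (2 * ∫ X : Fin m → α, rad (fun i j => g i (X j)) ∂π) := by
        rw [step2, step3]
        exact mul_le_mul_of_nonneg_left step4 (by positivity)
    _ = _ := by ring

/-- The Rademacher generalization bound for a finite class of bounded functions. -/
theorem le_measureReal_forall_integral_le (hm : 1 ≤ m) {g : ι → α → ℝ}
    (hg : ∀ i, Measurable (g i)) {c : ℝ} (hc0 : 0 < c) (hc : ∀ i x, g i x ∈ Set.Icc 0 c)
    {δ : ℝ} (hδ : δ ∈ Set.Ioo (0 : ℝ) 1) :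
    1 - δ ≤ (Measure.pi fun _ : Fin m => μ).real
      {X | ∀ i, ∫ x, g i x ∂μ ≤ 1 / (m : ℝ) * ∑ j, g i (X j) + 2 / m * rad (fun i j => g i (X j))
        + 4 * c * √(2 * Real.log (4 / δ) / m)} := by
  have hm0 : (0 : ℝ) < m := by exact_mod_cast hm
  set π : Measure (Fin m → α) := Measure.pi fun _ => μ
  have habs : ∀ i x, |g i x| ≤ c := fun i x => by
    rw [abs_of_nonneg (hc i x).1]; exact (hc i x).2
  set φ : (Fin m → α) → ℝ := fun X => ⨆ i, (∫ x, g i x ∂μ - 1 / (m : ℝ) * ∑ j, g i (X j)) with hφ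
  set R : (Fin m → α) → ℝ := fun X => rad fun i j => g i (X j) with hR
  have hφm : Measurable φ := Measurable.iSup fun i => by have := hg i; fun_prop
  have hRm : Measurable R :=
    measurable_rad (v := fun i (X : Fin m → α) j => g i (X j)) fun i j => by
      have := hg i; fun_prop
  have hRB : ∀ X, |R X| ≤ m * c := fun X => abs_rad_le fun i j => habs i _
  obtain ⟨B, hφB⟩ : ∃ B, ∀ X, |φ X| ≤ B := by
    refine ⟨(⨆ i, |∫ x, g i x ∂μ|) + c, fun X => abs_iSup_le fun i => ?_⟩
    refine (abs_sub _ _).trans (add_le_add (le_iSup_finite (fun i => |∫ x, g i x ∂μ|) i) ?_)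
    rw [abs_mul, abs_of_pos (by positivity), one_div, inv_mul_le_iff₀ hm0]
    simpa using abs_sum_mul_le (s := fun _ => 1) (by simp) fun j => habs i (X j)
  -- Concentrating this combination directly costs a single exceptional event. Changing one point
  -- moves `φ` by at most `c / m` and `R` by at most `c`, hence `F` by at most `3c / m`.
  set F : (Fin m → α) → ℝ := fun X => φ X - 2 / m * R X with hF
  have hFm : Measurable F := hφm.sub (hRm.const_mul _)
  have hFB : ∃ B, ∀ X, |F X| ≤ B := by
    refine ⟨B + 2 / m * (m * c), fun X => (abs_sub _ _).trans (add_le_add (hφB X) ?_)⟩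
    rw [abs_mul, abs_of_pos (by positivity)]
    exact mul_le_mul_of_nonneg_left (hRB X) (by positivity)
  have hFd : ∀ X i x, |F (Function.update X i x) - F X| ≤ 3 * c / m := by
    intro X k x
    have h1 : |φ (Function.update X k x) - φ X| ≤ c / m := by
      refine abs_iSup_sub_iSup_le fun i => ?_
      rw [sub_sub_sub_cancel_left, ← mul_sub, abs_mul, abs_of_pos (by positivity), one_div,
        inv_mul_le_iff₀ hm0, mul_div_cancel₀ _ hm0.ne', abs_sub_comm]
      simpa using abs_sum_update_sub_le (fun _ => 1) (by simp) (hc i) X k x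
    have h2 : |R (Function.update X k x) - R X| ≤ c :=
      abs_rad_sub_rad_le fun e i =>
        abs_sum_update_sub_le (fun j => sgn (e j)) (fun j => abs_sgn _) (hc i) X k x
    have h3 : F (Function.update X k x) - F X = (φ (Function.update X k x) - φ X)
        - 2 / m * (R (Function.update X k x) - R X) := by simp only [hF]; ring
    rw [h3]
    refine (abs_sub _ _).trans ?_
    rw [abs_mul, abs_of_pos (a := 2 / (m : ℝ)) (by positivity)]
    calc _ ≤ c / m + 2 / m * c := by gcongr
      _ = _ := by ring
  have hEF : ∫ X, F X ∂π ≤ 0 := by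
    have hφi : Integrable φ π := integrable_of_abs_le hφm hφB
    have hRi : Integrable R π := integrable_of_abs_le hRm hRB
    rw [hF, integral_sub hφi (hRi.const_mul _), integral_const_mul]
    linarith [integral_iSup_le_integral_rad μ hm hg hc]
  have hmd := measureReal_bounded_differences_le μ (by positivity : 0 < 3 * c / m) hm hFm hFd hFB hδ
  set A := {X | ∫ Z, F Z ∂π + 3 * c / m * √(2 * m * Real.log (1 / δ)) ≤ F X}
  have hA : MeasurableSet A := measurableSet_le measurable_const hFm
  have hAc : 1 - δ ≤ π.real Aᶜ := by
    rw [probReal_compl_eq_one_sub hA]; linarith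
  refine hAc.trans (measureReal_mono fun X hX i => ?_)
  have hX' : F X < ∫ Z, F Z ∂π + 3 * c / m * √(2 * m * Real.log (1 / δ)) := not_le.1 hX
  have hlog1 : 0 < Real.log (1 / δ) := Real.log_pos (by rw [lt_div_iff₀ hδ.1]; linarith [hδ.2])
  have hlog : Real.log (1 / δ) ≤ Real.log (4 / δ) := by
    have := hδ.1
    gcongr
    norm_num
  have ht : 3 * c / m * √(2 * m * Real.log (1 / δ)) ≤ 4 * c * √(2 * Real.log (4 / δ) / m) := by
    have e : √(2 * m * Real.log (1 / δ)) = m * √(2 * Real.log (1 / δ) / m) := by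
      rw [show 2 * m * Real.log (1 / δ) = m ^ 2 * (2 * Real.log (1 / δ) / m) by field_simp,
        Real.sqrt_mul (by positivity), Real.sqrt_sq hm0.le]
    rw [e, ← mul_assoc, div_mul_cancel₀ _ hm0.ne']
    gcongr
    norm_num
  have hi := le_iSup_finite (fun i => ∫ x, g i x ∂μ - 1 / (m : ℝ) * ∑ j, g i (X j)) i
  have : φ X - 2 / m * R X < 4 * c * √(2 * Real.log (4 / δ) / m) := by
    change F X < _
    linarith
  have h8 : φ X = ⨆ i, (∫ x, g i x ∂μ - 1 / (m : ℝ) * ∑ j, g i (X j)) := rfl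
  rw [← h8] at hi
  linarith

end Symmetrization

/-! ### The shrinkage operator and the projection onto the ball -/

section Activation

theorem shrink_eq {t : ℝ} (ht : 0 ≤ t) (x : ℝ) :
    shrink t x = if t < x then x - t else if x < -t then x + t else 0 := by
  unfold shrink
  split_ifs with h1 h2 h3 h4 h5
  · linarith [(abs_le.1 h1).2]
  · linarith [(abs_le.1 h1).1]
  · rfl
  · rw [Real.sign_of_pos (by linarith)]; ring
  · rw [Real.sign_of_neg (by linarith)]; ring
  · exact absurd (abs_le.2 ⟨by linarith, by linarith⟩) h1

theorem abs_shrink_sub_le {t : ℝ} (ht : 0 ≤ t) (x y : ℝ) :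
    |shrink t x - shrink t y| ≤ |x - y| := by
  rw [shrink_eq ht, shrink_eq ht, abs_le]
  have h1 := le_abs_self (x - y)
  have h2 := neg_abs_le (x - y)
  split_ifs <;> constructor <;> linarith

theorem shrinkVec_zero {d : ℕ} {t : ℝ} (ht : 0 ≤ t) : shrinkVec t (0 : Vec d) = 0 := by
  ext i
  simp [shrinkVec, shrink, ht]

theorem norm_shrinkVec_sub_le {d : ℕ} {t : ℝ} (ht : 0 ≤ t) (v w : Vec d) :
    ‖shrinkVec t v - shrinkVec t w‖ ≤ ‖v - w‖ := by
  rw [EuclideanSpace.norm_eq, EuclideanSpace.norm_eq]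
  refine Real.sqrt_le_sqrt (Finset.sum_le_sum fun i _ => ?_)
  simp only [Real.norm_eq_abs, sq_abs]
  exact sq_le_sq.2 (abs_shrink_sub_le ht (v i) (w i))

theorem norm_shrinkVec_le {d : ℕ} {t : ℝ} (ht : 0 ≤ t) (v : Vec d) : ‖shrinkVec t v‖ ≤ ‖v‖ := by
  simpa [shrinkVec_zero ht] using norm_shrinkVec_sub_le ht v 0

theorem continuous_shrinkVec {d : ℕ} {t : ℝ} (ht : 0 ≤ t) :
    Continuous (shrinkVec t : Vec d → Vec d) :=
  (LipschitzWith.of_dist_le_mul (K := 1) fun v w => by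
    simpa [dist_eq_norm] using norm_shrinkVec_sub_le ht v w).continuous

variable {N : ℕ} {B : ℝ}

theorem norm_clip_le (hB : 0 ≤ B) (x : Vec N) : ‖clip B x‖ ≤ B := by
  unfold clip
  split_ifs with h
  · exact h
  · push Not at h
    have hx : 0 < ‖x‖ := hB.trans_lt h
    rw [norm_smul, Real.norm_of_nonneg (by positivity), div_mul_cancel₀ _ hx.ne']

/-- The variational inequality characterizing `clip` as the metric projection onto the ball; adding
it for two points gives nonexpansiveness. -/
theorem inner_sub_clip_le (hB : 0 ≤ B) (x w : Vec N) (hw : ‖w‖ ≤ B) :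
    inner ℝ (x - clip B x) (w - clip B x) ≤ 0 := by
  unfold clip
  split_ifs with h
  · simp
  · push Not at h
    have hx : 0 < ‖x‖ := hB.trans_lt h
    set s := B / ‖x‖ with hs
    have hs1 : s ≤ 1 := (div_le_one hx).2 h.le
    have hsx : s * ‖x‖ = B := div_mul_cancel₀ _ hx.ne'
    have e : x - s • x = (1 - s) • x := by rw [sub_smul, one_smul]
    rw [e, real_inner_smul_left, inner_sub_right, real_inner_smul_right, real_inner_self_eq_norm_sq]
    have h1 : inner ℝ x w ≤ ‖x‖ * B := (real_inner_le_norm x w).trans (by gcongr)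
    refine mul_nonpos_of_nonneg_of_nonpos (by linarith) ?_
    nlinarith

theorem norm_clip_sub_le (hB : 0 ≤ B) (x y : Vec N) : ‖clip B x - clip B y‖ ≤ ‖x - y‖ := by
  have h1 := inner_sub_clip_le hB x (clip B y) (norm_clip_le hB y)
  have h2 := inner_sub_clip_le hB y (clip B x) (norm_clip_le hB x)
  set p := clip B x
  set q := clip B y
  have h3 : ‖p - q‖ ^ 2 ≤ inner ℝ (x - y) (p - q) := by
    rw [← real_inner_self_eq_norm_sq]
    have e : inner ℝ (x - y) (p - q) - inner ℝ (p - q) (p - q)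
        = -inner ℝ (x - p) (q - p) - inner ℝ (y - q) (p - q) := by
      simp only [inner_sub_left, inner_sub_right]; ring
    linarith
  have h4 := h3.trans (real_inner_le_norm _ _)
  by_contra! hcon
  nlinarith [norm_nonneg (x - y)]

theorem continuous_clip (hB : 0 ≤ B) : Continuous (clip B : Vec N → Vec N) :=
  (LipschitzWith.of_dist_le_mul (K := 1) fun v w => by
    simpa [dist_eq_norm] using norm_clip_sub_le hB v w).continuous

end Activation

/-! ### Matrices and their norms -/

section MatrixNorms

variable {a b c : ℕ}

theorem mulE_sub (M : Matrix (Fin a) (Fin b) ℝ) (v w : Vec b) :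
    mulE M (v - w) = mulE M v - mulE M w := by
  ext i; simp [mulE, Matrix.mulVec_sub]

theorem sub_mulE (M M' : Matrix (Fin a) (Fin b) ℝ) (v : Vec b) :
    mulE (M - M') v = mulE M v - mulE M' v := by
  ext i; simp [mulE, Matrix.sub_mulVec]

theorem continuous_mulE :
    Continuous fun p : Matrix (Fin a) (Fin b) ℝ × Vec b => mulE p.1 p.2 := by
  unfold mulE
  refine (PiLp.continuous_toLp 2 _).comp ?_
  exact continuous_fst.matrix_mulVec ((PiLp.continuous_ofLp 2 _).comp continuous_snd)

theorem inner_mulE_transpose (M : Matrix (Fin a) (Fin b) ℝ) (u : Vec a) (v : Vec b) :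
    inner ℝ (mulE M.transpose u) v = inner ℝ u (mulE M v) := by
  simp only [mulE, PiLp.inner_apply, Matrix.mulVec, dotProduct, Matrix.transpose_apply,
    RCLike.inner_apply, conj_trivial, Finset.mul_sum, Finset.sum_mul]
  rw [Finset.sum_comm]
  exact Finset.sum_congr rfl fun i _ => Finset.sum_congr rfl fun j _ => by ring

theorem specNorm_nonneg (M : Matrix (Fin a) (Fin b) ℝ) : 0 ≤ specNorm M := by
  open scoped Matrix.Norms.L2Operator in exact norm_nonneg M

theorem norm_mulE_le (M : Matrix (Fin a) (Fin b) ℝ) (v : Vec b) :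
    ‖mulE M v‖ ≤ specNorm M * ‖v‖ := by
  open scoped Matrix.Norms.L2Operator in exact Matrix.l2_opNorm_mulVec M v

theorem specNorm_transpose (M : Matrix (Fin a) (Fin b) ℝ) : specNorm M.transpose = specNorm M := by
  open scoped Matrix.Norms.L2Operator in
  rw [← Matrix.conjTranspose_eq_transpose_of_trivial]
  exact Matrix.l2_opNorm_conjTranspose M

theorem specNorm_mul_le (M : Matrix (Fin a) (Fin b) ℝ) (M' : Matrix (Fin b) (Fin c) ℝ) :
    specNorm (M * M') ≤ specNorm M * specNorm M' := by
  open scoped Matrix.Norms.L2Operator in exact Matrix.l2_opNorm_mul M M'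

theorem norm_mulE_of_mem_orthogonalGroup {Ψ : Matrix (Fin a) (Fin a) ℝ}
    (hΨ : Ψ ∈ Matrix.orthogonalGroup (Fin a) ℝ) (v : Vec a) : ‖mulE Ψ v‖ = ‖v‖ := by
  have h : mulE Ψ.transpose (mulE Ψ v) = v := by
    have := (Matrix.mem_orthogonalGroup_iff' (Fin a) ℝ).1 hΨ
    change Ψ.transpose * Ψ = 1 at this
    ext i
    simp [mulE, this]
  have h2 : ‖mulE Ψ v‖ ^ 2 = ‖v‖ ^ 2 := by
    rw [← real_inner_self_eq_norm_sq, ← inner_mulE_transpose, h, real_inner_self_eq_norm_sq]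
  exact (sq_eq_sq₀ (norm_nonneg _) (norm_nonneg _)).1 h2

theorem specNorm_le_of_forall {M : Matrix (Fin a) (Fin b) ℝ} {C : ℝ} (hC : 0 ≤ C)
    (h : ∀ v, ‖mulE M v‖ ≤ C * ‖v‖) : specNorm M ≤ C := by
  open scoped Matrix.Norms.L2Operator in
  rw [specNorm, Matrix.l2_opNorm_def]
  exact ContinuousLinearMap.opNorm_le_bound _ hC h

theorem specNorm_le_one {Ψ : Matrix (Fin a) (Fin a) ℝ}
    (hΨ : Ψ ∈ Matrix.orthogonalGroup (Fin a) ℝ) : specNorm Ψ ≤ 1 :=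
  specNorm_le_of_forall zero_le_one fun v => by
    rw [norm_mulE_of_mem_orthogonalGroup hΨ, one_mul]

theorem specNorm_mul_orthogonal_le (M : Matrix (Fin a) (Fin b) ℝ) {Φ : Matrix (Fin b) (Fin b) ℝ}
    (hΦ : Φ ∈ Matrix.orthogonalGroup (Fin b) ℝ) : specNorm (M * Φ) ≤ specNorm M :=
  (specNorm_mul_le M Φ).trans
    (mul_le_of_le_one_right (specNorm_nonneg M) (specNorm_le_one hΦ))

theorem frobNorm_nonneg (M : Matrix (Fin a) (Fin b) ℝ) : 0 ≤ frobNorm M := by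
  open scoped Matrix.Norms.Frobenius in exact norm_nonneg M

theorem frobNorm_measMatrix_sq {m : ℕ} (A : Matrix (Fin a) (Fin b) ℝ) (X : Fin m → Vec b) :
    frobNorm (measMatrix A X) ^ 2 = ∑ i, ‖mulE A (X i)‖ ^ 2 := by
  open scoped Matrix.Norms.Frobenius in
  rw [frobNorm, Matrix.frobenius_norm_def, ← Real.sqrt_eq_rpow, Real.sq_sqrt (by positivity),
    Finset.sum_comm]
  refine Finset.sum_congr rfl fun i _ => ?_
  rw [EuclideanSpace.norm_sq_eq]
  simp [measMatrix]

theorem measurable_frobNorm_measMatrix {m : ℕ} (A : Matrix (Fin a) (Fin b) ℝ) :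
    Measurable fun X : Fin m → Vec b => frobNorm (measMatrix A X) := by
  have h : (fun X : Fin m → Vec b => frobNorm (measMatrix A X))
      = fun X => √(∑ i, ‖mulE A (X i)‖ ^ 2) := by
    funext X
    rw [← frobNorm_measMatrix_sq, Real.sqrt_sq (frobNorm_nonneg _)]
  rw [h]
  have hc : Continuous fun v : Vec b => mulE A v :=
    continuous_mulE.comp (continuous_const.prodMk continuous_id)
  refine Continuous.measurable ?_
  fun_prop

end MatrixNorms

/-! ### Perturbation bounds for the network -/

section Network

variable {n N : ℕ} (A : Matrix (Fin n) (Fin N) ℝ) {τ lam : ℝ}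

/-- Expanding the square, the quadratic term is at most `τ‖Mz‖²` because `τ‖M‖² ≤ 1`, and the cross
term `-2τ‖Mz‖²` absorbs it. -/
theorem norm_sub_smul_mulE_le (hτ : 0 ≤ τ) {M : Matrix (Fin n) (Fin N) ℝ}
    (hM : τ * specNorm M ^ 2 ≤ 1) (z : Vec N) :
    ‖z - τ • mulE M.transpose (mulE M z)‖ ≤ ‖z‖ := by
  refine (sq_le_sq₀ (norm_nonneg _) (norm_nonneg _)).1 ?_
  have h1 : inner ℝ z (mulE M.transpose (mulE M z)) = ‖mulE M z‖ ^ 2 := by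
    rw [real_inner_comm, inner_mulE_transpose, real_inner_self_eq_norm_sq]
  rw [norm_sub_sq_real, real_inner_smul_right, h1, norm_smul, Real.norm_of_nonneg hτ]
  have h2 := norm_mulE_le M.transpose (mulE M z)
  rw [specNorm_transpose] at h2
  have h3 : ‖mulE M.transpose (mulE M z)‖ ^ 2 ≤ specNorm M ^ 2 * ‖mulE M z‖ ^ 2 := by
    rw [← mul_pow]
    gcongr
  have h4 : (τ * ‖mulE M.transpose (mulE M z)‖) ^ 2 ≤ τ * ‖mulE M z‖ ^ 2 := by
    calc (τ * ‖mulE M.transpose (mulE M z)‖) ^ 2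
        = τ ^ 2 * ‖mulE M.transpose (mulE M z)‖ ^ 2 := by ring
      _ ≤ τ ^ 2 * (specNorm M ^ 2 * ‖mulE M z‖ ^ 2) := by gcongr
      _ = (τ * specNorm M ^ 2) * (τ * ‖mulE M z‖ ^ 2) := by ring
      _ ≤ 1 * (τ * ‖mulE M z‖ ^ 2) := by gcongr
      _ = _ := one_mul _
  have h5 : 0 ≤ τ * ‖mulE M z‖ ^ 2 := by positivity
  linarith

theorem norm_smul_mulE_transpose_le (hτ : 0 ≤ τ) {M : Matrix (Fin n) (Fin N) ℝ} {s : ℝ}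
    (hM : specNorm M ≤ s) (y : Vec n) : ‖τ • mulE M.transpose y‖ ≤ τ * s * ‖y‖ := by
  rw [norm_smul, Real.norm_of_nonneg hτ, mul_assoc]
  have := norm_mulE_le M.transpose y
  rw [specNorm_transpose] at this
  gcongr
  exact this.trans (by gcongr)

variable {A} {s : ℝ} {Φ Φ' : Matrix (Fin N) (Fin N) ℝ}

/-- A layer is a nonexpansive map plus `τ(AΦ)ᵀy`, so each one adds at most `τ s ‖y‖`. -/
theorem norm_iterate_layer_le (hτ : 0 ≤ τ) (hlam : 0 ≤ lam) (hs : τ * s ^ 2 ≤ 1)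
    (hΦ : specNorm (A * Φ) ≤ s) (y : Vec n) (k : ℕ) :
    ‖(layer A τ lam Φ y)^[k] (firstLayer A τ lam Φ y)‖ ≤ (k + 1) * (τ * s * ‖y‖) := by
  have hM : τ * specNorm (A * Φ) ^ 2 ≤ 1 := le_trans (by
    have := specNorm_nonneg (A * Φ)
    gcongr) hs
  induction k with
  | zero =>
    simp only [Function.iterate_zero, id, Nat.cast_zero, zero_add, one_mul]
    exact (norm_shrinkVec_le (by positivity) _).trans (norm_smul_mulE_transpose_le hτ hΦ y)
  | succ k ih =>
    rw [Function.iterate_succ_apply']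
    set z := (layer A τ lam Φ y)^[k] (firstLayer A τ lam Φ y)
    refine (norm_shrinkVec_le (by positivity) _).trans ?_
    have e : z + τ • mulE (A * Φ).transpose (y - mulE (A * Φ) z)
        = (z - τ • mulE (A * Φ).transpose (mulE (A * Φ) z)) + τ • mulE (A * Φ).transpose y := by
      rw [mulE_sub, smul_sub]; abel
    rw [e]
    refine (norm_add_le _ _).trans ?_
    have h1 := norm_sub_smul_mulE_le hτ hM z
    have h2 := norm_smul_mulE_transpose_le hτ hΦ y
    push_cast
    linarith

/-- The previous error passes through nonexpansively. The change of dictionary adds `τd‖y‖` directly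
and two terms `τsd‖z'‖`; since `‖z'‖` grows linearly and `τs² ≤ 1`, the increment is at most
`(2(k+1) + 1) τd‖y‖`, and these odd numbers sum to squares. -/
theorem norm_iterate_layer_sub_le (hτ : 0 ≤ τ) (hlam : 0 ≤ lam) (hs : τ * s ^ 2 ≤ 1)
    (hΦ : specNorm (A * Φ) ≤ s) (hΦ' : specNorm (A * Φ') ≤ s) (y : Vec n) (k : ℕ) :
    ‖(layer A τ lam Φ y)^[k] (firstLayer A τ lam Φ y)
        - (layer A τ lam Φ' y)^[k] (firstLayer A τ lam Φ' y)‖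
      ≤ (k + 1) ^ 2 * (τ * specNorm (A * Φ - A * Φ') * ‖y‖) := by
  have hM : τ * specNorm (A * Φ) ^ 2 ≤ 1 := le_trans (by
    have := specNorm_nonneg (A * Φ)
    gcongr) hs
  have hs0 : 0 ≤ s := (specNorm_nonneg _).trans hΦ
  set d := specNorm (A * Φ - A * Φ') with hd
  have hd0 : 0 ≤ d := specNorm_nonneg _
  have hdiff : ∀ u : Vec n, ‖τ • mulE (A * Φ - A * Φ').transpose u‖ ≤ τ * d * ‖u‖ :=
    norm_smul_mulE_transpose_le hτ le_rfl
  induction k with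
  | zero =>
    simp only [Function.iterate_zero, id, Nat.cast_zero, zero_add, one_pow, one_mul]
    refine (norm_shrinkVec_sub_le (by positivity) _ _).trans ?_
    rw [← smul_sub, ← sub_mulE, ← Matrix.transpose_sub]
    exact hdiff y
  | succ k ih =>
    have hz := norm_iterate_layer_le hτ hlam hs hΦ' y k
    rw [Function.iterate_succ_apply', Function.iterate_succ_apply']
    set z := (layer A τ lam Φ y)^[k] (firstLayer A τ lam Φ y)
    set z' := (layer A τ lam Φ' y)^[k] (firstLayer A τ lam Φ' y)
    refine (norm_shrinkVec_sub_le (by positivity) _ _).trans ?_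
    have e : z + τ • mulE (A * Φ).transpose (y - mulE (A * Φ) z)
          - (z' + τ • mulE (A * Φ').transpose (y - mulE (A * Φ') z'))
        = ((z - z') - τ • mulE (A * Φ).transpose (mulE (A * Φ) (z - z')))
          - τ • mulE (A * Φ).transpose (mulE (A * Φ - A * Φ') z')
          - τ • mulE (A * Φ - A * Φ').transpose (mulE (A * Φ') z')
          + τ • mulE (A * Φ - A * Φ').transpose y := by
      simp only [mulE_sub, sub_mulE, Matrix.transpose_sub, smul_sub]; abel
    rw [e]
    have h1 := norm_sub_smul_mulE_le hτ hM (z - z')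
    have h2 : ‖τ • mulE (A * Φ).transpose (mulE (A * Φ - A * Φ') z')‖ ≤ τ * s * (d * ‖z'‖) :=
      (norm_smul_mulE_transpose_le hτ hΦ _).trans (by gcongr; exact norm_mulE_le _ _)
    have h3 : ‖τ • mulE (A * Φ - A * Φ').transpose (mulE (A * Φ') z')‖ ≤ τ * d * (s * ‖z'‖) :=
      (hdiff _).trans (by
        gcongr
        exact (norm_mulE_le _ _).trans (by gcongr))
    have h4 := hdiff y
    have h5 : τ * s * (d * ‖z'‖) ≤ (k + 1) * (τ * d * ‖y‖) := by
      calc τ * s * (d * ‖z'‖) ≤ τ * s * (d * ((k + 1) * (τ * s * ‖y‖))) := by gcongr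
        _ = (τ * s ^ 2) * ((k + 1) * (τ * d * ‖y‖)) := by ring
        _ ≤ 1 * ((k + 1) * (τ * d * ‖y‖)) := by gcongr
        _ = _ := one_mul _
    have h6 : τ * d * (s * ‖z'‖) = τ * s * (d * ‖z'‖) := by ring
    refine (norm_add_le _ _).trans ?_
    refine (add_le_add ((norm_sub_le _ _).trans (add_le_add (norm_sub_le _ _) le_rfl)) le_rfl).trans ?_
    push_cast
    nlinarith

theorem norm_net_le (hτ : 0 ≤ τ) (hlam : 0 ≤ lam) (hs : τ * s ^ 2 ≤ 1)
    (hΦ : specNorm (A * Φ) ≤ s) {L : ℕ} (hL : 1 ≤ L) (y : Vec n) :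
    ‖net A τ lam L Φ y‖ ≤ L * (τ * s * ‖y‖) := by
  have := norm_iterate_layer_le hτ hlam hs hΦ y (L - 1)
  rw [Nat.cast_sub hL] at this
  simpa [net] using this

theorem norm_net_sub_le (hτ : 0 ≤ τ) (hlam : 0 ≤ lam) (hs : τ * s ^ 2 ≤ 1)
    (hΦ : specNorm (A * Φ) ≤ s) (hΦ' : specNorm (A * Φ') ≤ s) {L : ℕ} (hL : 1 ≤ L) (y : Vec n) :
    ‖net A τ lam L Φ y - net A τ lam L Φ' y‖
      ≤ L ^ 2 * (τ * specNorm (A * Φ - A * Φ') * ‖y‖) := by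
  have := norm_iterate_layer_sub_le hτ hlam hs hΦ hΦ' y (L - 1)
  rw [Nat.cast_sub hL] at this
  simpa [net] using this

variable (A τ lam) in
/-- The hypothesis `y ↦ σ(Ψ f_Φ^L(y))`. -/
def hyp (B : ℝ) (L : ℕ) (p : Matrix (Fin N) (Fin N) ℝ × Matrix (Fin N) (Fin N) ℝ) (y : Vec n) :
    Vec N :=
  clip B (mulE p.1 (net A τ lam L p.2 y))

theorem norm_hyp_sub_le (hτ : 0 ≤ τ) (hlam : 0 ≤ lam) (hs : τ * s ^ 2 ≤ 1) {B : ℝ} (hB : 0 ≤ B)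
    (hΦ : specNorm (A * Φ) ≤ s) (hΦ' : specNorm (A * Φ') ≤ s)
    {Ψ Ψ' : Matrix (Fin N) (Fin N) ℝ} (hΨ' : Ψ' ∈ Matrix.orthogonalGroup (Fin N) ℝ)
    {L : ℕ} (hL : 1 ≤ L) (y : Vec n) :
    ‖hyp A τ lam B L (Ψ, Φ) y - hyp A τ lam B L (Ψ', Φ') y‖
      ≤ (L * (τ * s) * specNorm (Ψ - Ψ') + L ^ 2 * τ * specNorm (A * Φ - A * Φ')) * ‖y‖ := by
  refine (norm_clip_sub_le hB _ _).trans ?_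
  set z := net A τ lam L Φ y with hz
  set z' := net A τ lam L Φ' y with hz'
  have e : mulE Ψ z - mulE Ψ' z' = mulE (Ψ - Ψ') z + mulE Ψ' (z - z') := by
    rw [sub_mulE, mulE_sub]; abel
  rw [e]
  refine (norm_add_le _ _).trans ?_
  rw [norm_mulE_of_mem_orthogonalGroup hΨ']
  have h1 : ‖mulE (Ψ - Ψ') z‖ ≤ specNorm (Ψ - Ψ') * (L * (τ * s * ‖y‖)) :=
    (norm_mulE_le _ _).trans (mul_le_mul_of_nonneg_left (norm_net_le hτ hlam hs hΦ hL y)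
      (specNorm_nonneg _))
  have h2 := norm_net_sub_le hτ hlam hs hΦ hΦ' hL y
  linarith

variable (A τ) in
theorem continuous_hyp (hτ : 0 ≤ τ) (hlam : 0 ≤ lam) {B : ℝ} (hB : 0 ≤ B) (L : ℕ) :
    Continuous fun q : (Matrix (Fin N) (Fin N) ℝ × Matrix (Fin N) (Fin N) ℝ) × Vec n =>
      hyp A τ lam B L q.1 q.2 := by
  have hsh : Continuous (shrinkVec (τ * lam) : Vec N → Vec N) :=
    continuous_shrinkVec (by positivity)
  have hM : ∀ {a b : ℕ} {f : (Matrix (Fin N) (Fin N) ℝ × Matrix (Fin N) (Fin N) ℝ) × Vec n →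
      Matrix (Fin a) (Fin b) ℝ} {g : _ → Vec b}, Continuous f → Continuous g →
      Continuous fun q => mulE (f q) (g q) := fun hf hg => continuous_mulE.comp (hf.prodMk hg)
  have hA : Continuous fun q : (Matrix (Fin N) (Fin N) ℝ × Matrix (Fin N) (Fin N) ℝ) × Vec n =>
      A * q.1.2 := by fun_prop
  have hit : ∀ k : ℕ, Continuous fun q : (Matrix (Fin N) (Fin N) ℝ × Matrix (Fin N) (Fin N) ℝ)
      × Vec n => (layer A τ lam q.1.2 q.2)^[k] (firstLayer A τ lam q.1.2 q.2) := by
    intro k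
    induction k with
    | zero => exact hsh.comp ((hM hA.matrix_transpose continuous_snd).const_smul τ)
    | succ k ih =>
      simp only [Function.iterate_succ_apply']
      exact hsh.comp (ih.add ((hM hA.matrix_transpose
        (continuous_snd.sub (hM hA ih))).const_smul τ))
  exact (continuous_clip hB).comp (hM (continuous_fst.comp continuous_fst) (hit (L - 1)))

end Network

/-! ### The Rademacher average of the hypothesis class -/

section Entropy

theorem exists_finset_specNorm_net {a b : ℕ} {S : Set (Matrix (Fin a) (Fin b) ℝ)}
    (hS : S.Nonempty) {R c η : ℝ} (hR : ∀ M ∈ S, specNorm M ≤ R) (hc : 0 ≤ c) (hη : 0 < η) :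
    ∃ T : Finset (Matrix (Fin a) (Fin b) ℝ), (T : Set (Matrix (Fin a) (Fin b) ℝ)) ⊆ S ∧
      T.Nonempty ∧ (T.card : ℝ) ≤ (1 + 2 * R * c / η) ^ (a * b) ∧
      ∀ M ∈ S, ∃ M' ∈ T, c * specNorm (M - M') ≤ η := by
  open scoped Matrix.Norms.L2Operator in
  have h := exists_finset_net hS hR hc hη
  rw [Module.finrank_matrix, Fintype.card_fin, Fintype.card_fin, Module.finrank_self, mul_one] at h
  exact h

/-- The parameter space `O(N) × O(N)`. -/
abbrev Params (N : ℕ) : Type :=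
  Matrix.orthogonalGroup (Fin N) ℝ × Matrix.orthogonalGroup (Fin N) ℝ

/-- Provides the dense sequence of parameters and the Borel structure arguments on products. -/
instance (N : ℕ) : SecondCountableTopology (Params N) :=
  have : SecondCountableTopology (Matrix (Fin N) (Fin N) ℝ) :=
    inferInstanceAs (SecondCountableTopology (Fin N → Fin N → ℝ))
  have : SecondCountableTopology (Matrix.orthogonalGroup (Fin N) ℝ) :=
    TopologicalSpace.Subtype.secondCountableTopology _
  inferInstance

variable {n N m : ℕ} (A : Matrix (Fin n) (Fin N) ℝ) (τ lam : ℝ)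

/-- The hypothesis with parameters in `O(N) × O(N)`. -/
def paramHyp (B : ℝ) (L : ℕ) (q : Params N) : Vec n → Vec N :=
  hyp A τ lam B L (q.1.1, q.2.1)

theorem paramHyp_mem_hypClass_iff (B : ℝ) (L : ℕ) (h : Vec n → Vec N) :
    h ∈ hypClass A τ lam B L ↔ ∃ q, h = paramHyp A τ lam B L q := by
  constructor
  · rintro ⟨Ψ, hΨ, Φ, hΦ, rfl⟩
    exact ⟨(⟨Ψ, hΨ⟩, ⟨Φ, hΦ⟩), rfl⟩
  · rintro ⟨q, rfl⟩
    exact ⟨q.1.1, q.1.2, q.2.1, q.2.2, rfl⟩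

/-- The loss of a hypothesis on `(x, A x)`, truncated at the level `c`. -/
def truncLoss (B : ℝ) (L : ℕ) (c : ℝ) (q : Params N) (x : Vec N) : ℝ :=
  min (loss (paramHyp A τ lam B L q) x (mulE A x)) c

variable {A τ lam} {Bout : ℝ} {L : ℕ}

theorem abs_min_norm_sub_le {d : ℕ} (u v w : Vec d) (c : ℝ) :
    |min ‖u - w‖ c - min ‖v - w‖ c| ≤ ‖u - v‖ := by
  refine (abs_min_sub_min_le_max _ _ _ _).trans (max_le ?_ (by simp))
  refine (abs_norm_sub_norm_le _ _).trans (le_of_eq ?_)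
  rw [sub_sub_sub_cancel_right]

theorem norm_paramHyp_le (hB : 0 ≤ Bout) (q : Params N) (y : Vec n) :
    ‖paramHyp A τ lam Bout L q y‖ ≤ Bout :=
  norm_clip_le hB _

theorem sum_truncLoss_sub_sq_le (hτ : 0 ≤ τ) (hlam : 0 ≤ lam) (hB : 0 ≤ Bout)
    (hA : τ * specNorm A ^ 2 ≤ 1) (hL : 1 ≤ L) (c : ℝ) (X : Fin m → Vec N) (q q' : Params N) :
    ∑ j, (truncLoss A τ lam Bout L c q (X j) - truncLoss A τ lam Bout L c q' (X j)) ^ 2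
      ≤ (L * (τ * specNorm A) * frobNorm (measMatrix A X) * specNorm (q.1.1 - q'.1.1)
        + L ^ 2 * τ * frobNorm (measMatrix A X) * specNorm (A * q.2.1 - A * q'.2.1)) ^ 2 := by
  set κ := L * (τ * specNorm A) * specNorm (q.1.1 - q'.1.1)
    + L ^ 2 * τ * specNorm (A * q.2.1 - A * q'.2.1) with hκ
  calc _ ≤ ∑ j, (κ * ‖mulE A (X j)‖) ^ 2 := by
        refine Finset.sum_le_sum fun j _ => ?_
        rw [← sq_abs]
        gcongr
        exact (abs_min_norm_sub_le _ _ _ _).trans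
          (norm_hyp_sub_le hτ hlam hA hB (specNorm_mul_orthogonal_le A q.2.2)
            (specNorm_mul_orthogonal_le A q'.2.2) q'.1.2 hL _)
    _ = (κ * frobNorm (measMatrix A X)) ^ 2 := by
        simp only [mul_pow, ← Finset.mul_sum]
        rw [frobNorm_measMatrix_sq]
    _ = _ := by rw [hκ]; ring

theorem exists_finset_params_net (hτ : 0 < τ) (hlam : 0 ≤ lam) (hB : 0 ≤ Bout)
    (hA : τ * specNorm A ^ 2 ≤ 1) (hL : 1 ≤ L) (c : ℝ) (X : Fin m → Vec N) {ρ : ℝ} (hρ : 0 < ρ)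
    (k : ℕ) :
    ∃ T : Finset (Params N), T.Nonempty ∧
      (T.card : ℝ) ≤
        (1 + 8 * (L * (L + 3) * τ * frobNorm (measMatrix A X) * specNorm A / ρ) * 2 ^ k) ^ (n * N)
        * (1 + 8 * (τ * L * specNorm A * frobNorm (measMatrix A X) / ρ) * 2 ^ k) ^ (N * N) ∧
      ∀ q, ∃ t ∈ T, ∑ j, (truncLoss A τ lam Bout L c q (X j)
        - truncLoss A τ lam Bout L c t (X j)) ^ 2 ≤ (ρ / 2 ^ (k + 1)) ^ 2 := by
  classical
  set Y := frobNorm (measMatrix A X) with hY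
  have hY0 : 0 ≤ Y := frobNorm_nonneg _
  have hs0 : 0 ≤ specNorm A := specNorm_nonneg A
  -- Half of the target accuracy for each of the two parameter nets.
  have hη : 0 < ρ / 2 ^ (k + 2) := by positivity
  obtain ⟨T₁, hT₁, hT₁n, hT₁c, hT₁net⟩ := exists_finset_specNorm_net
    (S := (Matrix.orthogonalGroup (Fin N) ℝ : Set (Matrix (Fin N) (Fin N) ℝ))) ⟨1, one_mem _⟩
    (R := 1) (fun M hM => specNorm_le_one hM)
    (by positivity : 0 ≤ L * (τ * specNorm A) * Y) hη
  obtain ⟨T₂, hT₂, hT₂n, hT₂c, hT₂net⟩ := exists_finset_specNorm_net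
    (S := Set.range fun Φ : Matrix.orthogonalGroup (Fin N) ℝ => A * Φ.1) ⟨_, 1, rfl⟩
    (R := specNorm A) (by rintro _ ⟨Φ, rfl⟩; exact specNorm_mul_orthogonal_le A Φ.2)
    (by positivity : 0 ≤ L ^ 2 * τ * Y) hη
  -- Every centre in the net of `A·O(N)` has the form `AΦ`, so it lifts to an orthogonal `Φ`.
  choose f hf using fun M : T₂ => hT₂ M.2
  let F : T₁ × T₂ → Params N := fun p => (⟨p.1.1, hT₁ p.1.2⟩, f p.2)
  have : Nonempty T₁ := hT₁n.to_subtype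
  have : Nonempty T₂ := hT₂n.to_subtype
  refine ⟨Finset.univ.image F, Finset.univ_nonempty.image _, ?_, fun q => ?_⟩
  · have h1 : ((Finset.univ.image F).card : ℝ) ≤ T₁.card * T₂.card := by
      have := Finset.card_image_le (s := Finset.univ) (f := F)
      rw [Finset.card_univ, Fintype.card_prod, Fintype.card_coe, Fintype.card_coe] at this
      exact_mod_cast this
    refine h1.trans ?_
    rw [mul_comm]
    refine mul_le_mul (hT₂c.trans (pow_le_pow_left₀ (by positivity) ?_ _))
      (hT₁c.trans (le_of_eq ?_)) (by positivity) (by positivity)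
    · have e : 2 * specNorm A * (L ^ 2 * τ * Y) / (ρ / 2 ^ (k + 2))
          = 8 * (L * L * τ * Y * specNorm A / ρ) * 2 ^ k := by
        field_simp; ring
      rw [e]
      gcongr
      linarith
    · congr 2
      field_simp; ring
  · obtain ⟨M₁, hM₁, h1⟩ := hT₁net q.1.1 q.1.2
    obtain ⟨M₂, hM₂, h2⟩ := hT₂net (A * q.2.1) ⟨q.2, rfl⟩
    refine ⟨F (⟨M₁, hM₁⟩, ⟨M₂, hM₂⟩), Finset.mem_image_of_mem _ (Finset.mem_univ _), ?_⟩
    refine (sum_truncLoss_sub_sq_le hτ.le hlam hB hA hL c X _ _).trans ?_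
    have h3 : A * (F (⟨M₁, hM₁⟩, ⟨M₂, hM₂⟩)).2.1 = M₂ := hf ⟨M₂, hM₂⟩
    rw [h3]
    have h4 : ρ / 2 ^ (k + 1) = ρ / 2 ^ (k + 2) + ρ / 2 ^ (k + 2) := by
      field_simp; ring
    rw [h4]
    have hn1 := specNorm_nonneg (q.1.1 - (F (⟨M₁, hM₁⟩, ⟨M₂, hM₂⟩)).1.1)
    have hn2 := specNorm_nonneg (A * q.2.1 - M₂)
    gcongr

theorem sqrt_add_le {x y : ℝ} (hx : 0 ≤ x) (hy : 0 ≤ y) : √(x + y) ≤ √x + √y := by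
  refine Real.sqrt_le_iff.2 ⟨by positivity, ?_⟩
  rw [add_sq, Real.sq_sqrt hx, Real.sq_sqrt hy]
  have : 0 ≤ 2 * √x * √y := by positivity
  linarith

theorem sum_sqrt_log_mul_le {u w : ℝ} (hu : 0 ≤ u) (hw : 0 ≤ w) (p q K : ℕ) :
    ∑ k ∈ Finset.range K,
        1 / 2 ^ k * √(2 * Real.log ((1 + u * 2 ^ k) ^ p * (1 + w * 2 ^ k) ^ q))
      ≤ 4 * (√p * √(1 + Real.log (1 + u)) + √q * √(1 + Real.log (1 + w))) := by
  have hlog : ∀ {x : ℝ}, 0 ≤ x → ∀ k : ℕ, 0 ≤ Real.log (1 + x * 2 ^ k) := fun hx k =>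
    Real.log_nonneg (by have : 0 ≤ _ * (2 : ℝ) ^ k := mul_nonneg hx (by positivity); linarith)
  have hterm : ∀ k : ℕ, √(2 * Real.log ((1 + u * 2 ^ k) ^ p * (1 + w * 2 ^ k) ^ q))
      ≤ √2 * (√p * √(Real.log (1 + u * 2 ^ k)) + √q * √(Real.log (1 + w * 2 ^ k))) := fun k => by
    rw [Real.log_mul (by positivity) (by positivity), Real.log_pow, Real.log_pow,
      Real.sqrt_mul (by norm_num), ← Real.sqrt_mul (Nat.cast_nonneg p),
      ← Real.sqrt_mul (Nat.cast_nonneg q)]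
    gcongr
    exact sqrt_add_le (mul_nonneg (by positivity) (hlog hu k))
      (mul_nonneg (by positivity) (hlog hw k))
  calc _ ≤ ∑ k ∈ Finset.range K, (√2 * √p * (1 / 2 ^ k * √(Real.log (1 + u * 2 ^ k)))
          + √2 * √q * (1 / 2 ^ k * √(Real.log (1 + w * 2 ^ k)))) := by
        refine Finset.sum_le_sum fun k _ => ?_
        refine (mul_le_mul_of_nonneg_left (hterm k) (by positivity)).trans (le_of_eq ?_)
        ring
    _ ≤ √2 * √p * (2.7 * √(1 + Real.log (1 + u))) + √2 * √q * (2.7 * √(1 + Real.log (1 + w))) := by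
        rw [Finset.sum_add_distrib, ← Finset.mul_sum, ← Finset.mul_sum]
        gcongr
        · exact sum_sqrt_log_le hu K
        · exact sum_sqrt_log_le hw K
    _ = (√2 * 2.7) * (√p * √(1 + Real.log (1 + u)) + √q * √(1 + Real.log (1 + w))) := by ring
    _ ≤ _ := by
        gcongr
        -- The factor `4` comes from `1.42 * 2.7 < 4`.
        have : √2 ≤ 1.42 := by rw [Real.sqrt_le_left (by norm_num)]; norm_num
        linarith

theorem two_div_mul_rad_add_le_genBound {ι : Type*} [Finite ι] [Nonempty ι] (hm : 1 ≤ m)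
    (hτ : 0 < τ) (hlam : 0 ≤ lam) (hB : 0 < Bout) (hA : τ * specNorm A ^ 2 ≤ 1) (hL : 1 ≤ L)
    (Bin δ : ℝ) (X : Fin m → Vec N) (p : ι → Params N) :
    2 / m * rad (fun i j => truncLoss A τ lam Bout L (Bin + Bout) (p i) (X j))
        + 4 * (Bin + Bout) * √(2 * Real.log (4 / δ) / m)
      ≤ genBound A τ Bin Bout δ L X := by
  have hm0 : (0 : ℝ) < m := by exact_mod_cast hm
  set Y := frobNorm (measMatrix A X) with hY
  have hY0 : 0 ≤ Y := frobNorm_nonneg _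
  have hs0 : 0 ≤ specNorm A := specNorm_nonneg A
  -- Chaining starts from the loss vector of the zero predictor; outputs have norm at most `Bout`,
  -- so every loss vector is within `√m * Bout` of it.
  set ρ := √m * Bout with hρ
  have hρ0 : 0 < ρ := by positivity
  set u := 8 * (L * (L + 3) * τ * Y * specNorm A / ρ) with hu
  set w := 8 * (τ * L * specNorm A * Y / ρ) with hw
  have hu0 : 0 ≤ u := by positivity
  have hw0 : 0 ≤ w := by positivity
  set R := rad (fun i j => truncLoss A τ lam Bout L (Bin + Bout) (p i) (X j)) with hR
  set V := √(n * N : ℕ) * √(1 + Real.log (1 + u)) + √(N * N : ℕ) * √(1 + Real.log (1 + w)) with hV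
  have hdud : ∀ K : ℕ, R ≤ ρ * (4 * V) + ρ / 2 ^ K * √m := fun K => by
    refine (rad_le_dudley_sum (fun q j => truncLoss A τ lam Bout L (Bin + Bout) q (X j))
      (fun j => min ‖(0 : Vec N) - X j‖ (Bin + Bout)) hρ0.le (fun q => ?_)
      (fun k => (1 + u * 2 ^ k) ^ (n * N) * (1 + w * 2 ^ k) ^ (N * N))
      (exists_finset_params_net hτ hlam hB.le hA hL (Bin + Bout) X hρ0) p K).trans ?_
    · calc _ ≤ ∑ j : Fin m, Bout ^ 2 := by
            refine Finset.sum_le_sum fun j _ => ?_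
            rw [← sq_abs]
            refine pow_le_pow_left₀ (abs_nonneg _) ((abs_min_norm_sub_le _ _ _ _).trans ?_) 2
            rw [sub_zero]
            exact norm_paramHyp_le hB.le q _
        _ = _ := by
            rw [hρ, mul_pow, Real.sq_sqrt hm0.le]; simp
    · refine add_le_add ?_ le_rfl
      refine le_trans (le_of_eq ?_) (mul_le_mul_of_nonneg_left
        (sum_sqrt_log_mul_le hu0 hw0 (n * N) (N * N) K) hρ0.le)
      rw [Finset.mul_sum]
      exact Finset.sum_congr rfl fun k _ => by ring
  -- The Dudley bound holds at every depth `K`, and its discretization remainder vanishes as `K →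
  -- ∞`.
  have hlim : Filter.Tendsto (fun K : ℕ => ρ * (4 * V) + ρ / 2 ^ K * √m) Filter.atTop
      (nhds (ρ * (4 * V) + 0 * √m)) := by
    refine tendsto_const_nhds.add (Filter.Tendsto.mul_const _ ?_)
    exact tendsto_const_nhds.div_atTop (tendsto_pow_atTop_atTop_of_one_lt one_lt_two)
  have hRV : R ≤ ρ * (4 * V) := by
    have := ge_of_tendsto' hlim hdud
    simpa using this
  have hmm : √(m : ℝ) * √m = m := Real.mul_self_sqrt hm0.le
  have hsm : 0 < √(m : ℝ) := Real.sqrt_pos.2 hm0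
  have h1 : 2 / m * R ≤ 8 * Bout / √m * V := by
    calc 2 / m * R ≤ 2 / m * (ρ * (4 * V)) := by gcongr
      _ = 8 * Bout / √m * V := by
        rw [hρ]; nth_rewrite 1 [← hmm]; field_simp; ring
  have h2 : √((N : ℝ) * n / m) = √(n * N : ℕ) / √m := by
    rw [Real.sqrt_div (by positivity)]; push_cast; rw [mul_comm]
  have h3 : √((N * N : ℕ) : ℝ) = N := by
    push_cast; exact Real.sqrt_mul_self (by positivity)
  have h4 : 1 + Real.log (1 + u)
      ≤ 1 + Real.log (2 + 8 * L * (L + 3) * τ * Y * specNorm A / (√m * Bout)) := by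
    have e : u = 8 * L * (L + 3) * τ * Y * specNorm A / (√m * Bout) := by rw [hu, hρ]; ring
    rw [← e]
    gcongr
    norm_num
  have h5 : 1 + Real.log (1 + w)
      = Real.log (Real.exp 1 * (1 + 8 * τ * L * specNorm A * Y / (√m * Bout))) := by
    have e : w = 8 * τ * L * specNorm A * Y / (√m * Bout) := by rw [hw, hρ]; ring
    rw [← e, Real.log_mul (Real.exp_pos 1).ne' (by positivity), Real.log_exp]
  rw [genBound, ← hY, ← h5, h2]
  have h6 : 8 * Bout / √m * V ≤ 8 * Bout * (√(n * N : ℕ) / √m)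
      * √(1 + Real.log (2 + 8 * L * (L + 3) * τ * Y * specNorm A / (√m * Bout)))
      + 8 * Bout * (N / √m) * √(1 + Real.log (1 + w)) := by
    rw [hV, h3, mul_add]
    refine add_le_add ?_ (le_of_eq (by ring))
    calc _ = 8 * Bout * (√(n * N : ℕ) / √m) * √(1 + Real.log (1 + u)) := by ring
      _ ≤ _ := by gcongr
  linarith

end Entropy

/-! ### The generalization bound -/

section Generalization

variable {n N m : ℕ} (A : Matrix (Fin n) (Fin N) ℝ) {τ lam Bin Bout δ : ℝ} {L : ℕ}
  (D : Measure (Vec N))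

theorem continuous_loss_paramHyp (hτ : 0 ≤ τ) (hlam : 0 ≤ lam) (hB : 0 ≤ Bout) (L : ℕ) :
    Continuous fun z : Params N × Vec N =>
      loss (paramHyp A τ lam Bout L z.1) z.2 (mulE A z.2) := by
  have hmul : Continuous fun z : Params N × Vec N => mulE A z.2 :=
    continuous_mulE.comp (continuous_const.prodMk continuous_snd)
  have hq : Continuous fun z : Params N × Vec N => (z.1.1.1, z.1.2.1) := by fun_prop
  exact (((continuous_hyp A τ hτ hlam hB L).comp (hq.prodMk hmul)).sub continuous_snd).norm

theorem continuous_loss_paramHyp_left (hτ : 0 ≤ τ) (hlam : 0 ≤ lam) (hB : 0 ≤ Bout) (L : ℕ)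
    (x : Vec N) :
    Continuous fun q : Params N => loss (paramHyp A τ lam Bout L q) x (mulE A x) :=
  (continuous_loss_paramHyp A hτ hlam hB L).comp (f := fun q : Params N => (q, x)) (by fun_prop)

theorem measurable_loss_paramHyp (hτ : 0 ≤ τ) (hlam : 0 ≤ lam) (hB : 0 ≤ Bout) (L : ℕ)
    (q : Params N) :
    Measurable fun x => loss (paramHyp A τ lam Bout L q) x (mulE A x) :=
  ((continuous_loss_paramHyp A hτ hlam hB L).comp
    (f := fun x : Vec N => (q, x)) (by fun_prop)).measurable

theorem loss_paramHyp_le (hB : 0 ≤ Bout) {x : Vec N} (hx : ‖x‖ ≤ Bin) (q : Params N) (y : Vec n) :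
    loss (paramHyp A τ lam Bout L q) x y ≤ Bin + Bout := by
  have h1 := norm_sub_le (paramHyp A τ lam Bout L q y) x
  have h2 : ‖paramHyp A τ lam Bout L q y‖ ≤ Bout := norm_paramHyp_le hB q y
  rw [loss]
  linarith

/-- Dominated convergence with the almost sure bound `Bin + Bout`; needed to extend the inequality
from a dense set of parameters. -/
theorem continuous_trueLoss_paramHyp [IsProbabilityMeasure D] (hτ : 0 ≤ τ) (hlam : 0 ≤ lam) (hB : 0 ≤ Bout)
    (hD : ∀ᵐ x ∂D, ‖x‖ ≤ Bin) :
    Continuous fun q : Params N => trueLoss A D (paramHyp A τ lam Bout L q) := by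
  refine continuous_of_dominated (bound := fun _ => Bin + Bout) (fun q => ?_) (fun q => ?_)
    (integrable_const _) (Filter.Eventually.of_forall fun x => ?_)
  · exact (measurable_loss_paramHyp A hτ hlam hB L q).aestronglyMeasurable
  · filter_upwards [hD] with x hx
    rw [Real.norm_eq_abs, abs_of_nonneg (show 0 ≤ loss _ _ _ from norm_nonneg _)]
    exact loss_paramHyp_le A hB hx q _
  · exact continuous_loss_paramHyp_left A hτ hlam hB L x

theorem measurable_genBound (τ Bin Bout δ : ℝ) (L : ℕ) :
    Measurable fun X : Fin m → Vec N => genBound A τ Bin Bout δ L X := by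
  have := measurable_frobNorm_measMatrix (m := m) A
  unfold genBound
  fun_prop

theorem measurableSet_trueLoss_le (hτ : 0 ≤ τ) (hlam : 0 ≤ lam) (hB : 0 ≤ Bout) (q : Params N) :
    MeasurableSet {X : Fin m → Vec N | trueLoss A D (paramHyp A τ lam Bout L q)
      ≤ empLoss A X (paramHyp A τ lam Bout L q) + genBound A τ Bin Bout δ L X} := by
  refine measurableSet_le measurable_const (Measurable.add ?_ (measurable_genBound A τ Bin Bout δ L))
  unfold empLoss
  refine (Finset.measurable_sum _ fun j _ => ?_).const_mul _
  exact (measurable_loss_paramHyp A hτ hlam hB L q).comp (measurable_pi_apply j)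

theorem nonneg_of_ae_norm_le [IsProbabilityMeasure D] (hD : ∀ᵐ x ∂D, ‖x‖ ≤ Bin) : 0 ≤ Bin := by
  obtain ⟨x, hx⟩ := hD.exists
  exact (norm_nonneg x).trans hx

theorem le_measureReal_forall_finite [IsProbabilityMeasure D] {ι : Type*} [Finite ι]
    [Nonempty ι] (hm : 1 ≤ m)
    (hτ : 0 < τ) (hlam : 0 ≤ lam) (hB : 0 < Bout) (hδ : δ ∈ Set.Ioo (0 : ℝ) 1)
    (hA : τ * specNorm A ^ 2 ≤ 1) (hD : ∀ᵐ x ∂D, ‖x‖ ≤ Bin) (hL : 1 ≤ L) (p : ι → Params N) :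
    1 - δ ≤ (Measure.pi fun _ : Fin m => D).real
      {X | ∀ i, trueLoss A D (paramHyp A τ lam Bout L (p i))
        ≤ empLoss A X (paramHyp A τ lam Bout L (p i)) + genBound A τ Bin Bout δ L X} := by
  have hc0 : 0 < Bin + Bout := add_pos_of_nonneg_of_pos (nonneg_of_ae_norm_le D hD) hB
  have hmeas : ∀ i, Measurable (truncLoss A τ lam Bout L (Bin + Bout) (p i)) := fun i =>
    (measurable_loss_paramHyp A hτ.le hlam hB.le L (p i)).min measurable_const
  refine (le_measureReal_forall_integral_le D hm hmeas hc0
    (fun i x => ⟨le_min (norm_nonneg _) hc0.le, min_le_right _ _⟩) hδ).trans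
    (measureReal_mono fun X hX i => ?_)
  have h1 := hX i
  have h2 := two_div_mul_rad_add_le_genBound hm hτ hlam hB hA hL Bin δ X p
  -- Truncation is inactive almost surely, so the true loss is unchanged, while on an arbitrary
  -- sample it can only lower the empirical loss.
  have h3 : ∫ x, truncLoss A τ lam Bout L (Bin + Bout) (p i) x ∂D
      = trueLoss A D (paramHyp A τ lam Bout L (p i)) := by
    refine integral_congr_ae ?_
    filter_upwards [hD] with x hx
    exact min_eq_left (loss_paramHyp_le A hB.le hx (p i) _)
  have h4 : 1 / (m : ℝ) * ∑ j, truncLoss A τ lam Bout L (Bin + Bout) (p i) (X j)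
      ≤ empLoss A X (paramHyp A τ lam Bout L (p i)) := by
    unfold empLoss
    gcongr
    exact min_le_left _ _
  rw [h3] at h1
  linarith

theorem exists_measurableSet_forall_hypClass [IsProbabilityMeasure D] (hm : 1 ≤ m)
    (hτ : 0 < τ) (hlam : 0 ≤ lam) (hB : 0 < Bout) (hδ : δ ∈ Set.Ioo (0 : ℝ) 1)
    (hA : τ * specNorm A ^ 2 ≤ 1) (hD : ∀ᵐ x ∂D, ‖x‖ ≤ Bin) (hL : 1 ≤ L) :
    ∃ E : Set (Fin m → Vec N), MeasurableSet E ∧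
      1 - δ ≤ (Measure.pi fun _ : Fin m => D).real E ∧
      ∀ X ∈ E, ∀ h ∈ hypClass A τ lam Bout L,
        trueLoss A D h ≤ empLoss A X h + genBound A τ Bin Bout δ L X := by
  set π : Measure (Fin m → Vec N) := Measure.pi fun _ => D
  set G : Params N → Set (Fin m → Vec N) := fun q =>
    {X | trueLoss A D (paramHyp A τ lam Bout L q)
      ≤ empLoss A X (paramHyp A τ lam Bout L q) + genBound A τ Bin Bout δ L X} with hG
  have hGm : ∀ q, MeasurableSet (G q) := measurableSet_trueLoss_le A D hτ.le hlam hB.le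
  let d : ℕ → Params N := TopologicalSpace.denseSeq (Params N)
  have hEm : MeasurableSet (⋂ k, G (d k)) := MeasurableSet.iInter fun k => hGm _
  refine ⟨⋂ k, G (d k), hEm, ?_, fun X hX h hh => ?_⟩
  -- The failure events of the first `k + 1` hypotheses increase with `k`, and each has probability
  -- at most `δ`; continuity from below bounds their union.
  · have hcompl : π (⋂ k, G (d k))ᶜ ≤ ENNReal.ofReal δ := by
      rw [Set.compl_iInter, measure_iUnion_eq_iSup_accumulate]
      refine iSup_le fun k => ?_
      have hfin := le_measureReal_forall_finite (ι := Fin (k + 1)) A D hm hτ hlam hB hδ hA hD hL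
        fun i => d i
      have hset : {X : Fin m → Vec N | ∀ i : Fin (k + 1),
          trueLoss A D (paramHyp A τ lam Bout L (d i))
          ≤ empLoss A X (paramHyp A τ lam Bout L (d i)) + genBound A τ Bin Bout δ L X}
          = (Set.accumulate (fun k => (G (d k))ᶜ) k)ᶜ := by
        ext X
        simp only [Set.accumulate_def, Set.compl_iUnion, compl_compl, Set.mem_iInter, hG,
          Set.mem_ofPred_eq]
        exact ⟨fun h i hi => h ⟨i, Nat.lt_succ_of_le hi⟩, fun h i => h i (Nat.le_of_lt_succ i.2)⟩
      have hacc : MeasurableSet (Set.accumulate (fun k => (G (d k))ᶜ) k) := by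
        rw [Set.accumulate_def]
        exact MeasurableSet.iUnion fun i => MeasurableSet.iUnion fun _ => (hGm _).compl
      rw [hset, probReal_compl_eq_one_sub hacc] at hfin
      rw [← ENNReal.ofReal_toReal (measure_ne_top π _)]
      refine ENNReal.ofReal_le_ofReal ?_
      change π.real _ ≤ δ
      linarith
    have h1 : π.real (⋂ k, G (d k))ᶜ ≤ δ := ENNReal.toReal_le_of_le_ofReal hδ.1.le hcompl
    rw [probReal_compl_eq_one_sub hEm] at h1
    linarith
  · obtain ⟨q, rfl⟩ := (paramHyp_mem_hypClass_iff A τ lam Bout L h).1 hh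
    -- For a fixed sample the valid parameters form a closed set; it contains the dense sequence,
    -- hence is everything.
    have hcl : IsClosed {q : Params N | trueLoss A D (paramHyp A τ lam Bout L q)
        ≤ empLoss A X (paramHyp A τ lam Bout L q) + genBound A τ Bin Bout δ L X} := by
      refine isClosed_le (continuous_trueLoss_paramHyp A D hτ.le hlam hB.le hD)
        (Continuous.add ?_ continuous_const)
      unfold empLoss
      refine continuous_const.mul (continuous_finsetSum _ fun j _ => ?_)
      exact continuous_loss_paramHyp_left A hτ.le hlam hB.le L (X j)
    exact (TopologicalSpace.denseRange_denseSeq (Params N)).induction_on q hcl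
      fun k => Set.mem_iInter.1 hX k

end Generalization

/-! ### Growth of the bound in the number of layers -/

section Growth

variable {n N m : ℕ} (A : Matrix (Fin n) (Fin N) ℝ) {τ Bin Bout : ℝ}

theorem frobNorm_measMatrix_le (hBin : 0 ≤ Bin) {X : Fin m → Vec N} (hX : ∀ i, ‖X i‖ ≤ Bin) :
    frobNorm (measMatrix A X) ≤ √m * (specNorm A * Bin) := by
  have hs := specNorm_nonneg A
  refine (sq_le_sq₀ (frobNorm_nonneg _) (by positivity)).1 ?_
  rw [frobNorm_measMatrix_sq, mul_pow, Real.sq_sqrt (by positivity)]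
  calc _ ≤ ∑ i : Fin m, (specNorm A * Bin) ^ 2 := by
        refine Finset.sum_le_sum fun i _ => ?_
        gcongr
        exact (norm_mulE_le A (X i)).trans (by gcongr; exact hX i)
    _ = _ := by simp

/-- For `L ≥ 2` the constant `1 + log a` is at most a multiple of `log L ≥ log 2`. -/
theorem one_add_log_le_mul_log {z a : ℝ} (ha : 1 ≤ a) {L : ℕ} (hL : 2 ≤ L) (hz : 0 < z)
    (hza : z ≤ a * L ^ 2) :
    1 + Real.log z ≤ ((1 + Real.log a) / Real.log 2 + 2) * Real.log L := by
  have hL2 : (2 : ℝ) ≤ L := by exact_mod_cast hL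
  have hlog2 : 0 < Real.log 2 := Real.log_pos one_lt_two
  have h1 : Real.log 2 ≤ Real.log L := Real.log_le_log two_pos hL2
  have h2 := Real.log_le_log hz hza
  rw [Real.log_mul (by positivity) (by positivity), Real.log_pow] at h2
  have h3 : 1 + Real.log a ≤ (1 + Real.log a) / Real.log 2 * Real.log L := by
    rw [div_mul_eq_mul_div, le_div_iff₀ hlog2]
    have := Real.log_nonneg ha
    gcongr
  push_cast at h2
  linarith

theorem exists_genBound_le_mul_sqrt_log (hτ : 0 ≤ τ) (hBin : 0 ≤ Bin) (hB : 0 < Bout) (δ : ℝ) :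
    ∃ C : ℝ, ∀ L : ℕ, 2 ≤ L → ∀ X : Fin m → Vec N, (∀ i, ‖X i‖ ≤ Bin) →
      genBound A τ Bin Bout δ L X ≤ C * √(Real.log L) := by
  have hs := specNorm_nonneg A
  have hlog2 : 0 < Real.log 2 := Real.log_pos one_lt_two
  set Q := √m * (specNorm A * Bin) with hQ
  have hQ0 : 0 ≤ Q := by positivity
  -- One `a` serves both logarithms: `L (L + 3) ≤ 4 L²` gives `32 = 8 * 4`, and `Q` bounds `‖Y‖_F`
  -- for every admissible sample.
  set a := 2 + 32 * τ * Q * specNorm A / (√m * Bout) with ha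
  have ha1 : 1 ≤ a := by
    have : 0 ≤ 32 * τ * Q * specNorm A / (√m * Bout) := by positivity
    linarith
  set c := (1 + Real.log a) / Real.log 2 + 2 with hc
  have hc0 : 0 ≤ c := by have := Real.log_nonneg ha1; positivity
  set T := 4 * (Bin + Bout) * √(2 * Real.log (4 / δ) / m) with hT
  have hT0 : 0 ≤ T := by positivity
  refine ⟨8 * Bout * √((N : ℝ) * n / m) * √c + 8 * Bout * (N / √m) * √c + T / √(Real.log 2),
    fun L hL X hX => ?_⟩
  have hL2 : (2 : ℝ) ≤ L := by exact_mod_cast hL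
  have hY0 := frobNorm_nonneg (measMatrix A X)
  have hY : frobNorm (measMatrix A X) ≤ Q := frobNorm_measMatrix_le A hBin hX
  set Y := frobNorm (measMatrix A X)
  have hLsq : (1 : ℝ) ≤ L ^ 2 := one_le_pow₀ (by linarith)
  have e : a * (L : ℝ) ^ 2 = 2 * L ^ 2 + 8 * (4 * L ^ 2) * τ * Q * specNorm A / (√m * Bout) := by
    rw [ha]; ring
  have h1 : 1 + Real.log (2 + 8 * L * (L + 3) * τ * Y * specNorm A / (√m * Bout))
      ≤ c * Real.log L := by
    refine one_add_log_le_mul_log ha1 hL (by positivity) ?_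
    rw [e]
    refine add_le_add (by linarith) ?_
    have : 8 * (L : ℝ) * (L + 3) ≤ 8 * (4 * L ^ 2) := by nlinarith
    gcongr
  have h2 : Real.log (Real.exp 1 * (1 + 8 * τ * L * specNorm A * Y / (√m * Bout)))
      ≤ c * Real.log L := by
    rw [Real.log_mul (Real.exp_pos 1).ne' (by positivity), Real.log_exp]
    refine one_add_log_le_mul_log ha1 hL (by positivity) ?_
    rw [e]
    refine add_le_add (by linarith) ?_
    have h3 : (L : ℝ) ≤ 4 * L ^ 2 := by nlinarith
    calc 8 * τ * L * specNorm A * Y / (√m * Bout)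
        = 8 * L * τ * Y * specNorm A / (√m * Bout) := by ring
      _ ≤ _ := by gcongr
  have h3 : T ≤ T / √(Real.log 2) * √(Real.log L) := by
    rw [div_mul_eq_mul_div, le_div_iff₀ (Real.sqrt_pos.2 hlog2)]
    gcongr
  have h4 := Real.sqrt_le_sqrt h1
  have h5 := Real.sqrt_le_sqrt h2
  rw [Real.sqrt_mul hc0] at h4 h5
  calc genBound A τ Bin Bout δ L X
      ≤ 8 * Bout * √((N : ℝ) * n / m) * (√c * √(Real.log L))
        + 8 * Bout * (N / √m) * (√c * √(Real.log L)) + T / √(Real.log 2) * √(Real.log L) := by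
        unfold genBound
        gcongr
    _ = _ := by ring

end Growth

end

end LISTA

theorem mainTheorem3 {n N m : ℕ} (hm : 1 ≤ m)
    (A : Matrix (Fin n) (Fin N) ℝ) (τ lam Bin Bout δ : ℝ)
    (hτ : 0 < τ) (hlam : 0 < lam) (hBout : 0 < Bout)
    (hδ : δ ∈ Set.Ioo (0 : ℝ) 1)
    (hA : τ * LISTA.specNorm A ^ 2 ≤ 1)
    (D : MeasureTheory.Measure (LISTA.Vec N)) [MeasureTheory.IsProbabilityMeasure D]
    (hD : ∀ᵐ x ∂D, ‖x‖ ≤ Bin) :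
    -- the generalization bound, with probability at least `1 - δ` over `x_1, …, x_m ∼ D` i.i.d.
    (∀ L : ℕ, 1 ≤ L →
      ∃ E : Set (Fin m → LISTA.Vec N), MeasurableSet E ∧
        1 - δ ≤ (MeasureTheory.Measure.pi fun _ : Fin m => D).real E ∧
        ∀ X ∈ E, ∀ h ∈ LISTA.hypClass A τ lam Bout L,
          LISTA.trueLoss A D h ≤ LISTA.empLoss A X h + LISTA.genBound A τ Bin Bout δ L X) ∧
    -- the bound grows at most like the square root of `log L`, uniformly in the sample
    (∃ C : ℝ, ∀ L : ℕ, 2 ≤ L → ∀ X : Fin m → LISTA.Vec N, (∀ i, ‖X i‖ ≤ Bin) →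
      LISTA.genBound A τ Bin Bout δ L X ≤ C * √(Real.log L)) :=
  ⟨fun _ hL => LISTA.exists_measurableSet_forall_hypClass A D hm hτ hlam.le hBout hδ hA hD hL,
    LISTA.exists_genBound_le_mul_sqrt_log A hτ.le (LISTA.nonneg_of_ae_norm_le D hD) hBout δ⟩
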